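/- Work in ZFC; regular cardinals are infinite, and $H(\theta)$ is the set of all sets whose transitive closure has size less than $\theta$. A *weak $\kappa$-model* is a (not necessarily transitive) set $M$ of size $\kappa$ with $\kappa+1\subseteq M$ and $\langle M,\in\rangle\models\mathsf{ZFC}^-$, where $\mathsf{ZFC}^-$ is $\mathsf{ZFC}$ without the power set axiom and with the collection scheme in place of replacement (and choice as the well-ordering principle). An elementary embedding $j\colon M\to N$ is *$\kappa$-powerset preserving* if its critical point is $\kappa$ and $M$ and $N$ have the same subsets of $\kappa$. For regular cardinals $\alpha\le\kappa$, $\kappa$ is *$\alpha$-Ramsey* if for arbitrarily large regular cardinals $\theta$, every $A\subseteq\kappa$ is an element of some weak $\kappa$-model $M\prec H(\theta)$ which is closed under ${<}\alpha$-sequences and for which there exists a $\kappa$-powerset preserving elementary embedding $j\colon M\to N$ into a transitive set $N$. A cardinal $\kappa$ is *measurable* if it is uncountable and carries a nonprincipal ${<}\kappa$-complete ultrafilter. **Statement.** Let $\kappa$ be a measurable cardinal. Then $\kappa$ is a limit of regular cardinals $\alpha<\kappa$ which are $\alpha$-Ramsey; that is, for every cardinal $\beta<\kappa$ there is a regular cardinal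 $\alpha$ with $\beta<\alpha<\kappa$ such that $\alpha$ is $\alpha$-Ramsey. In particular, the top of the hierarchy lies strictly below measurability: $\kappa$ is itself $\kappa$-Ramsey, and there is a regular cardinal $\alpha<\kappa$ which is $\alpha$-Ramsey but not measurable. -/

import Mathlib

universe u

open scoped FirstOrder

namespace LargeCardinal

/-! ### First-order structures of sets -/

/-- The relation symbols of the language of set theory: one binary symbol. -/
inductive SetRel : ℕ → Type
  | mem : SetRel 2

/-- The first-order language of set theory. -/
def setLang : FirstOrder.Language.{0, 0} := ⟨fun _ => Empty, SetRel⟩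

/-- A class `S` of sets is regarded as the structure `⟨S, ∈⟩`. -/
instance memStructure (S : Set ZFSet.{u}) : setLang.Structure S where
  funMap := fun f => f.elim
  RelMap := fun r => match r with
    | SetRel.mem => fun x => (x 0 : ZFSet.{u}) ∈ (x 1 : ZFSet.{u})

/-- `IsElementarySubmodel M K` means that `⟨M, ∈⟩` is an elementary substructure of `⟨K, ∈⟩`. -/
def IsElementarySubmodel (M K : Set ZFSet.{u}) : Prop :=
  ∃ h : M ⊆ K, ∀ ⦃n : ℕ⦄ (φ : setLang.Formula (Fin n)) (x : Fin n → M),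
    φ.Realize (Set.inclusion h ∘ x) ↔ φ.Realize x

/-! ### The theory `ZFC⁻` -/

/-- `⟨S, ∈⟩` believes that `p` is the Kuratowski pair `(x, y) = {{x}, {x, y}}`. -/
def IsPairIn (S : Set ZFSet.{u}) (p x y : S) : Prop :=
  ∀ z : S, z.1 ∈ p.1 ↔
    (∀ t : S, t.1 ∈ z.1 ↔ t = x) ∨ (∀ t : S, t.1 ∈ z.1 ↔ t = x ∨ t = y)

/-- `⟨S, ∈⟩` is a model of `ZFC⁻`, that is `ZFC` without the power set axiom, with the collection
scheme in place of replacement and with choice in the form of the well-ordering principle.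
All quantifiers range over `S`, which need not be transitive; the two schemes range over all
first-order formulas, with parameters from `S`. -/
structure ModelsZFCMinus (S : Set ZFSet.{u}) : Prop where
  extensionality : ∀ a b : S, (∀ x : S, x.1 ∈ a.1 ↔ x.1 ∈ b.1) → a = b
  foundation : ∀ a : S, (∃ x : S, x.1 ∈ a.1) →
    ∃ x : S, x.1 ∈ a.1 ∧ ∀ y : S, y.1 ∈ x.1 → y.1 ∉ a.1
  pairing : ∀ a b : S, ∃ c : S, ∀ x : S, x.1 ∈ c.1 ↔ x = a ∨ x = b
  union : ∀ a : S, ∃ b : S, ∀ x : S, x.1 ∈ b.1 ↔ ∃ y : S, y.1 ∈ a.1 ∧ x.1 ∈ y.1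
  infinity : ∃ w : S, (∃ e : S, e.1 ∈ w.1 ∧ ∀ x : S, x.1 ∉ e.1) ∧
    ∀ x : S, x.1 ∈ w.1 → ∃ y : S, y.1 ∈ w.1 ∧ ∀ z : S, z.1 ∈ y.1 ↔ z.1 ∈ x.1 ∨ z = x
  separation : ∀ (n : ℕ) (φ : setLang.Formula (Fin (n + 1))) (p : Fin n → S) (a : S),
    ∃ b : S, ∀ x : S, x.1 ∈ b.1 ↔ x.1 ∈ a.1 ∧ φ.Realize (Fin.cons x p : Fin (n + 1) → S)
  collection : ∀ (n : ℕ) (φ : setLang.Formula (Fin (n + 2))) (p : Fin n → S) (a : S),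
    (∀ x : S, x.1 ∈ a.1 →
      ∃ y : S, φ.Realize (Fin.cons x (Fin.cons y p : Fin (n + 1) → S) : Fin (n + 2) → S)) →
    ∃ b : S, ∀ x : S, x.1 ∈ a.1 → ∃ y : S, y.1 ∈ b.1 ∧
      φ.Realize (Fin.cons x (Fin.cons y p : Fin (n + 1) → S) : Fin (n + 2) → S)
  /-- Every set `a` carries a linear order `r` for which every nonempty subset of `a` has a
  least element. -/
  wellOrdering : ∀ a : S, ∃ r : S,
    (∀ x y : S, x.1 ∈ a.1 → y.1 ∈ a.1 →
      (∃ p : S, p.1 ∈ r.1 ∧ IsPairIn S p x y) →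
      (∃ p : S, p.1 ∈ r.1 ∧ IsPairIn S p y x) → x = y) ∧
    (∀ x y z : S, x.1 ∈ a.1 → y.1 ∈ a.1 → z.1 ∈ a.1 →
      (∃ p : S, p.1 ∈ r.1 ∧ IsPairIn S p x y) →
      (∃ p : S, p.1 ∈ r.1 ∧ IsPairIn S p y z) →
      ∃ p : S, p.1 ∈ r.1 ∧ IsPairIn S p x z) ∧
    (∀ b : S, (∀ x : S, x.1 ∈ b.1 → x.1 ∈ a.1) → (∃ x : S, x.1 ∈ b.1) →
      ∃ x : S, x.1 ∈ b.1 ∧ ∀ y : S, y.1 ∈ b.1 →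
        ∃ p : S, p.1 ∈ r.1 ∧ IsPairIn S p x y)

/-! ### Weak `κ`-models and `α`-Ramsey cardinals

The cardinal `κ` is identified, as a set, with the von Neumann ordinal `κ.ord.toZFSet`. -/

/-- `H(θ)`, the class of all sets whose transitive closure has size less than `θ`,
that is, which are included in a transitive set of size less than `θ`. -/
def H (θ : Cardinal.{u}) : Set ZFSet.{u} :=
  {x | ∃ t : ZFSet.{u}, t.IsTransitive ∧ x ⊆ t ∧ t.card < θ}

/-- A weak `κ`-model: a (not necessarily transitive) set `M` of size `κ` such that
`κ + 1 ⊆ M` and `⟨M, ∈⟩` is a model of `ZFC⁻`. -/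
structure IsWeakModel (κ : Cardinal.{u}) (M : ZFSet.{u}) : Prop where
  card_eq : M.card = κ
  succ_subset : (κ.ord + 1).toZFSet ⊆ M
  models : ModelsZFCMinus (M : Set ZFSet.{u})

/-- `M` is closed under `<α`-sequences: every function from an ordinal `β < α` to `M`
is an element of `M`. -/
def ClosedUnderSeq (α : Cardinal.{u}) (M : ZFSet.{u}) : Prop :=
  ∀ β < α.ord, ∀ f : ZFSet.{u}, ZFSet.IsFunc β.toZFSet M f → f ∈ M

/-- The elementary embedding `j : M → N` is `κ`-powerset preserving: its critical point (the least
ordinal that it moves) is `κ`, and `M` and `N` have the same subsets of `κ`. -/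
def IsPowersetPreserving (κ : Cardinal.{u}) {M N : ZFSet.{u}}
    (j : (M : Set ZFSet.{u}) ↪ₑ[setLang] (N : Set ZFSet.{u})) : Prop :=
  (∀ x : (M : Set ZFSet.{u}), x.1 ∈ κ.ord.toZFSet → (j x).1 = x.1) ∧
  (∃ k : (M : Set ZFSet.{u}), k.1 = κ.ord.toZFSet ∧ (j k).1 ≠ k.1) ∧
  ∀ X : ZFSet.{u}, X ⊆ κ.ord.toZFSet → (X ∈ M ↔ X ∈ N)

/-- `IsRamsey α κ` means that `α ≤ κ` are regular cardinals and that `κ` is `α`-Ramsey: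
for arbitrarily large regular cardinals `θ`, every `A ⊆ κ` is an element of some weak `κ`-model
`M ≺ H(θ)` which is closed under `<α`-sequences and for which there is a `κ`-powerset preserving
elementary embedding `j : M → N` into a transitive set `N`. -/
def IsRamsey (α κ : Cardinal.{u}) : Prop :=
  α ≤ κ ∧ α.IsRegular ∧ κ.IsRegular ∧
  ∀ μ : Cardinal.{u}, ∃ θ : Cardinal.{u}, μ ≤ θ ∧ θ.IsRegular ∧
    ∀ A : ZFSet.{u}, A ⊆ κ.ord.toZFSet →
      ∃ M : ZFSet.{u}, A ∈ M ∧ IsWeakModel κ M ∧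
        IsElementarySubmodel (M : Set ZFSet.{u}) (H θ) ∧ ClosedUnderSeq α M ∧
        ∃ N : ZFSet.{u}, N.IsTransitive ∧
          ∃ j : (M : Set ZFSet.{u}) ↪ₑ[setLang] (N : Set ZFSet.{u}), IsPowersetPreserving κ j

/-! ### Measurable cardinals -/

/-- `κ` is measurable: it is uncountable and there is a nonprincipal `<κ`-complete ultrafilter
on `κ`. -/
def IsMeasurable (κ : Cardinal.{u}) : Prop :=
  Cardinal.aleph0 < κ ∧ ∃ U : Ultrafilter κ.ord.ToType,
    (∀ x : κ.ord.ToType, ({x} : Set κ.ord.ToType) ∉ U) ∧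
    CardinalInterFilter (U : Filter κ.ord.ToType) κ

end LargeCardinal

universe v

namespace LargeCardinal

open Cardinal Set Filter
open scoped FirstOrder
open FirstOrder.Language (BoundedFormula Formula)

/-! A measurable cardinal `κ` is inaccessible and carries a normal measure `U`. Ramsey models come
from small pieces of the ultrapower of `H(θ)` by `U`: a family of `κ` many functions into `H(θ)`
that is closed under pointwise Skolem solutions satisfies Łoś's theorem modulo `U`, and its collapse
is a transitive set `N` (`exists_collapse`, `realize_iff_eventually`). If the family is also closed
under an operation that puts into `M` the subset of the critical point represented by each function,
then `N` has no subsets of it beyond those in `M` (`exists_isPowersetPreserving`).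

For `κ` itself, the functions have one variable, `M` consists of the values of the constant
functions in the family, and the embedding sends `x` to the class of the constant function `x`. By
normality the identity function represents `κ`.

For cardinals below `κ`, the family consists of functions `f k` of two variables, indexed by `k <
κ`. For almost every `a` the indices below `a` are closed under all operations. Let `M` be the set
of values `f k a a` with `k < a`, and let `N` be the collapse of the functions `f k a` with `k < a`.
The value `f k a a` is sent to the class of the diagonal function `y ↦ f k y y`. This is elementary
because, by normality, almost every `a` is typical: a formula holds of the values at `(a, a)` iff it
holds of those at `(y, y)` for almost every `y`. The cardinal `a` is sent to the class of the
identity, which lies above `a`. Hence almost every `a` has the required models for the given `θ`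
(`IsNormalMeasure.eventually_hasRamseyModel`).

Applied to the least measurable cardinal, this yields a Ramsey cardinal that is not measurable. -/

theorem exists_forall_lt_of_isRegular {κ : Cardinal.{u}} (hκ : κ.IsRegular) {ι : Type u}
    (hι : #ι < κ) (f : ι → κ.ord.ToType) : ∃ b, ∀ i, f i < b := by
  by_contra! h
  have hc : IsCofinal (range f) := fun b => by
    obtain ⟨i, hi⟩ := h b
    exact ⟨f i, ⟨i, rfl⟩, hi⟩
  have := Order.cof_le hc
  rw [Ordinal.cof_toType, hκ.cof_ord] at this
  exact (this.trans mk_range_le).not_gt hι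

theorem mk_Iio_ord_lt {κ : Cardinal.{u}} (a : κ.ord.ToType) : #(Iio a) < κ := by
  simpa using Cardinal.mk_Iio_lt a (by simp)

theorem mk_Iic_lt {κ : Cardinal.{u}} (hκ : ℵ₀ ≤ κ) (a : κ.ord.ToType) : #(Iic a) < κ := by
  rw [← Iio_insert]
  exact mk_insert_le.trans_lt (add_lt_of_lt hκ (mk_Iio_ord_lt a)
    (one_lt_aleph0.trans_le hκ))

/-- A nonprincipal `κ`-complete ultrafilter on `κ` that contains the final segments and for
which every regressive function is constant on a large set. -/
structure IsNormalMeasure {κ : Cardinal.{u}} (U : Ultrafilter κ.ord.ToType) : Prop where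
  complete : ∀ {ι : Type u} (p : ι → κ.ord.ToType → Prop), #ι < κ →
    (∀ i, ∀ᶠ x in (U : Filter κ.ord.ToType), p i x) → ∀ᶠ x in (U : Filter κ.ord.ToType), ∀ i, p i x
  tail : ∀ a, ∀ᶠ x in (U : Filter κ.ord.ToType), a < x
  regressive : ∀ f : κ.ord.ToType → κ.ord.ToType, (∀ᶠ x in (U : Filter κ.ord.ToType), f x < x) →
    ∃ c, ∀ᶠ x in (U : Filter κ.ord.ToType), f x = c

/-! ### From a complete ultrafilter to inaccessibility and a normal measure. -/

section Complete

variable {κ : Cardinal.{u}} {U : Ultrafilter κ.ord.ToType}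

theorem eventually_lt_of_complete (hκ : ℵ₀ ≤ κ) (hU : ∀ x, ({x} : Set κ.ord.ToType) ∉ U)
    [CardinalInterFilter (U : Filter κ.ord.ToType) κ] (a : κ.ord.ToType) :
    ∀ᶠ x in (U : Filter κ.ord.ToType), a < x := by
  have h : ∀ᶠ x in (U : Filter κ.ord.ToType), ∀ y : Iic a, x ≠ y.1 := by
    rw [eventually_cardinal_forall (mk_Iic_lt hκ a)]
    intro y
    exact Ultrafilter.compl_mem_iff_notMem.2 (hU y)
  filter_upwards [h] with x hx
  exact not_le.1 fun hxa => hx ⟨x, hxa⟩ rfl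

theorem isRegular_of_complete (hκ : ℵ₀ ≤ κ) (hU : ∀ x, ({x} : Set κ.ord.ToType) ∉ U)
    [CardinalInterFilter (U : Filter κ.ord.ToType) κ] : κ.IsRegular := by
  refine ⟨hκ, ?_⟩
  by_contra! h
  rw [← Ordinal.cof_toType] at h
  obtain ⟨s, hs, hsc⟩ := Order.exists_cof_eq κ.ord.ToType
  have : ∀ᶠ x in (U : Filter κ.ord.ToType), ∀ y : s, y.1 < x := by
    rw [eventually_cardinal_forall (hsc.trans_lt h)]
    exact fun y => eventually_lt_of_complete hκ hU _
  obtain ⟨x, hx⟩ := this.exists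
  obtain ⟨y, hy, hxy⟩ := hs x
  exact (hx ⟨y, hy⟩).not_ge hxy

/-- If `κ` many distinct subsets of `c` existed, a majority vote at each of the fewer than `κ`
points of `c` would single out one subset, so almost all indices would coincide and a singleton
would be large. -/
theorem two_power_lt_of_complete (hU : ∀ x, ({x} : Set κ.ord.ToType) ∉ U)
    [CardinalInterFilter (U : Filter κ.ord.ToType) κ] {c : Cardinal.{u}} (hc : c < κ) :
    2 ^ c < κ := by
  by_contra! h
  have h' : #κ.ord.ToType ≤ #(Set c.out) := by simpa using h
  obtain ⟨e⟩ := h'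
  have : ∀ᶠ x in (U : Filter κ.ord.ToType), ∀ i : c.out, i ∈ e x ↔ ∀ᶠ y in (U : Filter κ.ord.ToType), i ∈ e y := by
    rw [eventually_cardinal_forall (by simpa using hc)]
    intro i
    by_cases hi : ∀ᶠ y in (U : Filter κ.ord.ToType), i ∈ e y
    · filter_upwards [hi] with x hx
      simp [hx, hi]
    · filter_upwards [Ultrafilter.eventually_not.2 hi] with x hx
      simp [hx, hi]
  obtain ⟨x, hx⟩ := this.exists
  refine hU x (mem_of_superset this fun y hy => ?_)
  exact e.injective (Set.ext fun i => (hy i).trans (hx i).symm)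

theorem exists_isNormalMeasure (hκ : ℵ₀ < κ) (hU : ∀ x, ({x} : Set κ.ord.ToType) ∉ U)
    [CardinalInterFilter (U : Filter κ.ord.ToType) κ] :
    ∃ W : Ultrafilter κ.ord.ToType, IsNormalMeasure W := by
  let r : (κ.ord.ToType → κ.ord.ToType) → (κ.ord.ToType → κ.ord.ToType) → Prop :=
    fun f g => ∀ᶠ x in (U : Filter κ.ord.ToType), f x < g x
  have : CountableInterFilter (U : Filter κ.ord.ToType) :=
    CardinalInterFilter.toCountableInterFilter (c := κ) _ hκ
  have wf : WellFounded r := by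
    rw [wellFounded_iff_isEmpty_descending_chain]
    refine ⟨fun ⟨g, hg⟩ => ?_⟩
    obtain ⟨x, hx⟩ := (eventually_countable_forall.2 hg).exists
    exact (wellFounded_iff_isEmpty_descending_chain.1
      (wellFounded_lt (α := κ.ord.ToType))).false ⟨fun n => g n x, hx⟩
  -- Take `f` least modulo `U` among the functions that exceed every constant. Its image measure is
  -- normal: if `g` is regressive there, then `g ∘ f` is below `f`, so it is bounded by some `a` on
  -- a large set, and completeness makes it constant on a large set.
  obtain ⟨f, hf, hmin⟩ := wf.has_min {f | ∀ a, ∀ᶠ x in (U : Filter κ.ord.ToType), a < f x}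
    ⟨id, fun a => eventually_lt_of_complete hκ.le hU a⟩
  refine ⟨U.map f, ⟨fun p hι hp => ?_, hf, fun g hg => ?_⟩⟩
  · exact (eventually_cardinal_forall (l := (U : Filter κ.ord.ToType)) (p := fun x i => p i (f x)) hι).2 hp
  · obtain ⟨a, ha⟩ := not_forall.1 fun h => hmin (g ∘ f) h hg
    by_contra! hc
    have h2 : ∀ᶠ x in (U : Filter κ.ord.ToType), ∀ c : Iic a, g (f x) ≠ c.1 := by
      rw [eventually_cardinal_forall (mk_Iic_lt hκ.le a)]
      exact fun c => hc c
    refine ha ?_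
    filter_upwards [h2] with x hx
    exact not_le.1 fun h => hx ⟨_, h⟩ rfl

end Complete

/-! ### Consequences of normality. -/

namespace IsNormalMeasure

variable {κ : Cardinal.{u}} {U : Ultrafilter κ.ord.ToType}

theorem exists_eventually_eq (hU : IsNormalMeasure U) {ι : Type u} (hι : #ι < κ)
    {X : Type*} (f : κ.ord.ToType → X) (v : ι → X) (h : ∀ᶠ x in (U : Filter κ.ord.ToType), ∃ i, f x = v i) :
    ∃ i, ∀ᶠ x in (U : Filter κ.ord.ToType), f x = v i := by
  by_contra! hc
  obtain ⟨x, hx, i, hi⟩ :=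
    ((hU.complete _ hι hc).and h).exists
  exact hx i hi

/-- If this failed, choosing a bad `c < x` would be regressive, hence constant on a large set,
against the hypothesis for that one `c`. -/
theorem diagonal (hU : IsNormalMeasure U) {p : κ.ord.ToType → κ.ord.ToType → Prop}
    (h : ∀ c, ∀ᶠ x in (U : Filter κ.ord.ToType), p c x) : ∀ᶠ x in (U : Filter κ.ord.ToType), ∀ c < x, p c x := by
  by_contra hc
  rw [← Ultrafilter.eventually_not] at hc
  simp only [not_forall, exists_prop] at hc
  have : Nonempty κ.ord.ToType := ⟨hc.exists.choose⟩
  choose! f hf using fun x (hx : ∃ c < x, ¬ p c x) => hx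
  obtain ⟨c, hfc⟩ := hU.regressive f (hc.mono fun x hx => (hf x hx).1)
  obtain ⟨x, ⟨hx, hxc⟩, hp⟩ := ((hc.and hfc).and (h c)).exists
  exact (hf x hx).2 (hxc ▸ hp)

/-- Each coordinate of a short cofinal map into `x` is regressive in `x`, so for almost all such `x`
the map is one and the same. Its range is bounded in `κ` by regularity and cannot be cofinal in an
`x` above the bound. -/
theorem eventually_not_cofinal (hU : IsNormalMeasure U) (hκ : κ.IsRegular) :
    ∀ᶠ x in (U : Filter κ.ord.ToType), ∀ c < x,
      ¬ ∃ g : Iio c → κ.ord.ToType, (∀ i, g i < x) ∧ ∀ y < x, ∃ i, y ≤ g i := by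
  refine hU.diagonal fun c => ?_
  by_contra hc
  rw [← Ultrafilter.eventually_not] at hc
  simp only [not_not] at hc
  have : Nonempty κ.ord.ToType := ⟨c⟩
  choose! G hG using fun x (hx : ∃ g : Iio c → κ.ord.ToType,
    (∀ i, g i < x) ∧ ∀ y < x, ∃ i, y ≤ g i) => hx
  have h1 : ∀ i : Iio c, ∃ d, ∀ᶠ x in (U : Filter κ.ord.ToType), G x i = d := fun i =>
    hU.regressive (fun x => G x i) (hc.mono fun x hx => (hG x hx).1 i)
  choose h hh using h1
  obtain ⟨b, hb⟩ := exists_forall_lt_of_isRegular hκ (mk_Iio_ord_lt c) h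
  obtain ⟨x, ⟨hx, hxb⟩, hxh⟩ :=
    ((hc.and (hU.tail b)).and (hU.complete _ (mk_Iio_ord_lt c) hh)).exists
  obtain ⟨i, hi⟩ := (hG x hx).2 b hxb
  rw [hxh i] at hi
  exact (hb i).not_ge hi

end IsNormalMeasure

/-- The ordinal below `κ` that corresponds to a point of `κ.ord.ToType`. -/
noncomputable def position {κ : Cardinal.{u}} (x : κ.ord.ToType) : Ordinal.{u} :=
  Ordinal.typein (α := κ.ord.ToType) (· < ·) x

theorem position_lt_position {κ : Cardinal.{u}} {x y : κ.ord.ToType} :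
    position x < position y ↔ x < y :=
  Ordinal.typein_lt_typein (α := κ.ord.ToType) (· < ·)

theorem position_inj {κ : Cardinal.{u}} {x y : κ.ord.ToType} :
    position x = position y ↔ x = y :=
  Ordinal.typein_inj (α := κ.ord.ToType) (· < ·)

theorem position_lt {κ : Cardinal.{u}} (x : κ.ord.ToType) : position x < κ.ord :=
  Ordinal.typein_lt_self x

theorem exists_position_eq {κ : Cardinal.{u}} {o : Ordinal.{u}} (h : o < κ.ord) :
    ∃ x : κ.ord.ToType, position x = o :=
  Ordinal.typein_surj (α := κ.ord.ToType) (· < ·) (by rwa [Ordinal.type_toType])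

theorem mk_Iio_eq_card_position {κ : Cardinal.{u}} (x : κ.ord.ToType) :
    #(Iio x) = (position x).card := by
  rw [position, Ordinal.card_typein]; rfl

theorem IsNormalMeasure.eventually_isRegular {κ : Cardinal.{u}} {U : Ultrafilter κ.ord.ToType}
    (hU : IsNormalMeasure U) (hκ : κ.IsRegular) (hκ' : ℵ₀ < κ) :
    ∀ᶠ x in (U : Filter κ.ord.ToType), (#(Iio x)).IsRegular ∧
      (#(Iio x)).ord = position x := by
  obtain ⟨w, hw⟩ : ∃ w : κ.ord.ToType, position w = Ordinal.omega0 :=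
    exists_position_eq (by rw [lt_ord]; simpa using hκ')
  filter_upwards [hU.eventually_not_cofinal hκ, hU.tail w] with x hx hxw
  have hle : Ordinal.omega0 ≤ position x := by
    rw [← hw]; exact (position_lt_position.2 hxw).le
  have hcof : (position x).cof.ord =
      position x := by
    refine (Ordinal.ord_cof_le _).antisymm (le_of_not_gt fun hlt => ?_)
    obtain ⟨c, hc⟩ := exists_position_eq (hlt.trans (position_lt x))
    have hcx : c < x := by rw [← position_lt_position, hc]; exact hlt
    obtain ⟨s, hs, hsc⟩ := Order.exists_cof_eq (Iio x)
    rw [Order.cof_Iio] at hsc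
    have : #(Iio c) = #s := by
      rw [mk_Iio_eq_card_position, hc, card_ord, hsc, position]
    obtain ⟨e⟩ := Cardinal.eq.1 this
    refine hx c hcx ⟨fun i => (e i).1.1, fun i => (e i).1.2, fun y hy => ?_⟩
    obtain ⟨z, hz, hyz⟩ := hs ⟨y, hy⟩
    exact ⟨e.symm ⟨z, hz⟩, by simpa only [Equiv.apply_symm_apply] using! hyz⟩
  have hcard := congrArg Ordinal.card hcof
  rw [card_ord] at hcard
  rw [mk_Iio_eq_card_position, ← hcard]
  refine ⟨⟨?_, ?_⟩, hcof⟩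
  · rw [hcard, Ordinal.aleph0_le_card]; exact hle
  · rw [hcof]

/-! ### Enumerations of length `κ` closed under operations. -/

/-- A recursion with bookkeeping: each task `d` is scheduled `κ` many times, and so also at a stage
past `bound d`, when all the values that it consults are already defined. -/
theorem exists_enumeration {κ : Cardinal.{u}} (hκ : ℵ₀ ≤ κ) {T : Type v} {D : Type u}
    (hD : #D ≤ κ) (bound : D → κ.ord.ToType) (val : D → (κ.ord.ToType → T) → T)
    (hval : ∀ d f g, (∀ i < bound d, f i = g i) → val d f = val d g) [Nonempty T] :
    ∃ f : κ.ord.ToType → T, ∀ d, ∃ k, f k = val d f := by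
  rcases isEmpty_or_nonempty D with hD0 | hD0
  · exact ⟨fun _ => Classical.arbitrary T, fun d => hD0.elim d⟩
  have hcard : #(κ.ord.ToType × D) = #κ.ord.ToType := by
    rw [mk_prod, lift_id, lift_id, mk_ord_toType]
    exact mul_eq_left hκ hD (mk_ne_zero D)
  obtain ⟨e⟩ := Cardinal.eq.1 hcard.symm
  classical
  let t0 : T := Classical.arbitrary T
  let F : (k : κ.ord.ToType) → ((i : κ.ord.ToType) → i < k → T) → T := fun k f =>
    val (e k).2 fun i => if h : i < k then f i h else t0
  let f := (wellFounded_lt (α := κ.ord.ToType)).fix F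
  have hf : ∀ k, f k = val (e k).2 fun i => if i < k then f i else t0 := fun k => by
    have := (wellFounded_lt (α := κ.ord.ToType)).fix_eq F k
    simpa [f, F] using this
  refine ⟨f, fun d => ?_⟩
  -- Otherwise all `κ` many occurrences of the task `d` lie below `bound d`, which has fewer than
  -- `κ` predecessors.
  obtain ⟨k, hk, hkd⟩ : ∃ k, bound d ≤ k ∧ (e k).2 = d := by
    by_contra! h
    have hinj : Function.Injective fun i : κ.ord.ToType =>
        (⟨e.symm (i, d), not_le.1 fun hle => h _ hle (by simp)⟩ : Iio (bound d)) := by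
      intro i j hij
      simpa using congrArg Subtype.val hij
    exact ((mk_ord_toType κ).symm.trans_le (mk_le_of_injective hinj)).not_gt
      (mk_Iio_ord_lt _)
  refine ⟨k, ?_⟩
  rw [hf k, hkd]
  exact hval _ _ _ fun i hi => if_pos (hi.trans_le hk)

theorem mk_fun_Iio_lt {κ : Cardinal.{u}} (hκ : ∀ c < κ, 2 ^ c < κ) (hκ' : ℵ₀ ≤ κ)
    {ι : Type u} (hι : #ι < κ) (c : κ.ord.ToType) : #(ι → Iio c) < κ := by
  have h : #(ι → Iio c) ≤ #(Set (ι × Iio c)) :=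
    mk_le_of_injective (f := fun g : ι → Iio c => {p : ι × Iio c | g p.1 = p.2}) fun g g' h =>
      funext fun i => ((Set.ext_iff.1 h (i, g i)).1 rfl).symm
  refine h.trans_lt ?_
  rw [mk_set, mk_prod, lift_id, lift_id]
  exact hκ _ (mul_lt_of_lt hκ' hι (mk_Iio_ord_lt c))

/-- If `κ` is inaccessible, then any `κ` many points and countably many operations of arity `ω`
and of arities less than `κ` have a closure with an enumeration of length `κ`. -/
theorem exists_closed_enumeration {κ : Cardinal.{u}} (hκ : κ.IsRegular) (hκ₀ : ℵ₀ < κ)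
    (hκ₂ : ∀ c < κ, 2 ^ c < κ) {T : Type v} (seed : κ.ord.ToType → T)
    {O : Type} [Countable O] (op : O → (ℕ → T) → T) (seq : (b : κ.ord.ToType) → (Iio b → T) → T) :
    ∃ f : κ.ord.ToType → T, (∀ c, ∃ k, f k = seed c) ∧
      (∀ n (s : ℕ → κ.ord.ToType), ∃ k, f k = op n (f ∘ s)) ∧
      ∀ b (s : Iio b → κ.ord.ToType), ∃ k, f k = seq b (f ∘ s) := by
  let K := κ.ord.ToType
  have : Nonempty K := by
    rw [← mk_ne_zero_iff, mk_ord_toType]; exact (aleph0_pos.trans hκ₀).ne'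
  have : Nonempty T := ⟨seed (Classical.arbitrary K)⟩
  -- By regularity each short sequence of indices has a bound `c < κ`; recording `c` with the
  -- sequence keeps the number of tasks at most `κ`.
  let D := K ⊕ (Σ _ : ULift.{u} O, Σ c : K, (ULift.{u} ℕ → Iio c)) ⊕ (Σ b : K, Σ c : K, (Iio b → Iio c))
  have hN : #(ULift.{u} ℕ) < κ := by simpa using hκ₀
  have hO : #(ULift.{u} O) ≤ κ := mk_le_aleph0.trans hκ₀.le
  have hs : ∀ {ι : Type u}, #ι ≤ κ → ∀ F : ι → Type u, (∀ i, #(F i) ≤ κ) → #(Σ i, F i) ≤ κ := by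
    intro ι hι F hF
    rw [mk_sigma]
    calc _ ≤ sum fun _ : ι => κ := sum_le_sum _ _ hF
      _ = #ι * κ := by simp
      _ ≤ κ * κ := mul_le_mul_left hι _
      _ = κ := mul_eq_self hκ₀.le
  have hK : #K ≤ κ := (mk_ord_toType κ).le
  have hD : #D ≤ κ := by
    rw [mk_sum, mk_sum]
    simp only [lift_id]
    refine add_le_of_le hκ₀.le hK (add_le_of_le hκ₀.le ?_ ?_)
    · exact hs hO _ fun _ => hs hK _ fun c => (mk_fun_Iio_lt hκ₂ hκ₀.le hN c).le
    · exact hs hK _ fun b => hs hK _ fun c =>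
        (mk_fun_Iio_lt hκ₂ hκ₀.le (mk_Iio_ord_lt b) c).le
  obtain ⟨f, hf⟩ := exists_enumeration hκ₀.le hD
    (fun d => match d with
      | .inl c => c
      | .inr (.inl ⟨_, c, _⟩) => c
      | .inr (.inr ⟨_, c, _⟩) => c)
    (fun d f => match d with
      | .inl c => seed c
      | .inr (.inl ⟨n, _, s⟩) => op n.down fun m => f (s ⟨m⟩)
      | .inr (.inr ⟨b, _, s⟩) => seq b fun i => f (s i))
    (by
      rintro (c | ⟨n, c, s⟩ | ⟨b, c, s⟩) f g h
      · rfl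
      · exact congrArg _ (funext fun m => h _ (s _).2)
      · exact congrArg _ (funext fun m => h _ (s _).2))
  refine ⟨f, fun c => hf (.inl c), fun n s => ?_, fun b s => ?_⟩
  · obtain ⟨c, hc⟩ := exists_forall_lt_of_isRegular hκ hN (fun m => s m.down)
    exact hf (.inr (.inl ⟨⟨n⟩, c, fun m => ⟨s m.down, hc m⟩⟩))
  · obtain ⟨c, hc⟩ := exists_forall_lt_of_isRegular hκ (mk_Iio_ord_lt b) s
    exact hf (.inr (.inr ⟨b, c, fun i => ⟨s i, hc i⟩⟩))

/-! ### The classes `H(θ)` -/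

theorem card_range_le {α : Type u} (f : α → ZFSet.{u}) : (ZFSet.range f).card ≤ #α := by
  simpa using ZFSet.lift_card_range_le (f := f)

section H

variable {θ : Cardinal.{u}}

theorem mem_H_of_mem {x y : ZFSet.{u}} (hx : x ∈ H θ) (hy : y ∈ x) : y ∈ H θ := by
  obtain ⟨t, ht, hxt, hc⟩ := hx
  exact ⟨t, ht, ht y (hxt hy), hc⟩

theorem mem_H_of_subset {x y : ZFSet.{u}} (hx : x ∈ H θ) (hy : y ⊆ x) : y ∈ H θ := by
  obtain ⟨t, ht, hxt, hc⟩ := hx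
  exact ⟨t, ht, fun z hz => hxt (hy hz), hc⟩

theorem sUnion_mem_H {x : ZFSet.{u}} (hx : x ∈ H θ) : ZFSet.sUnion x ∈ H θ := by
  obtain ⟨t, ht, hxt, hc⟩ := hx
  refine ⟨t, ht, fun z hz => ?_, hc⟩
  obtain ⟨y, hy, hzy⟩ := ZFSet.mem_sUnion.1 hz
  exact ht y (hxt hy) hzy

theorem card_lt_of_mem_H {x : ZFSet.{u}} (hx : x ∈ H θ) : x.card < θ := by
  obtain ⟨t, ht, hxt, hc⟩ := hx
  exact (ZFSet.card_mono hxt).trans_lt hc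

theorem toZFSet_mem_H {o : Ordinal.{u}} (ho : o.card < θ) : o.toZFSet ∈ H θ :=
  ⟨_, (ZFSet.isOrdinal_toZFSet o).isTransitive, fun _ h => h, by simpa using ho⟩

theorem range_mem_H (hθ : θ.IsRegular) {α : Type u} (hα : #α < θ) {f : α → ZFSet.{u}}
    (hf : ∀ a, f a ∈ H θ) : ZFSet.range f ∈ H θ := by
  choose t ht hft hc using hf
  refine ⟨ZFSet.range f ∪ ZFSet.iUnion t, fun y hy => ?_, fun z hz => ZFSet.mem_union.2 (.inl hz), ?_⟩
  · intro z hz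
    refine ZFSet.mem_union.2 (.inr (ZFSet.mem_iUnion.2 ?_))
    rcases ZFSet.mem_union.1 hy with h | h
    · obtain ⟨a, rfl⟩ := ZFSet.mem_range.1 h
      exact ⟨a, hft a hz⟩
    · obtain ⟨a, ha⟩ := ZFSet.mem_iUnion.1 h
      exact ⟨a, ht a y ha hz⟩
  · refine ZFSet.card_union_le.trans_lt (add_lt_of_lt hθ.aleph0_le ((card_range_le f).trans_lt hα) ?_)
    have := ZFSet.lift_card_iUnion_le_sum_card (f := t)
    rw [lift_id] at this
    exact this.trans_lt (sum_lt_of_isRegular hθ hα hc)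

theorem pair_set_mem_H (hθ : θ.IsRegular) {x y : ZFSet.{u}} (hx : x ∈ H θ) (hy : y ∈ H θ) :
    ({x, y} : ZFSet) ∈ H θ := by
  have : ({x, y} : ZFSet) = ZFSet.range (fun b : ULift.{u} Bool => if b.down then x else y) := by
    ext z
    rw [ZFSet.mem_pair, ZFSet.mem_range, ULift.exists, Bool.exists_bool]
    simp [eq_comm (a := z), or_comm]
  rw [this]
  refine range_mem_H hθ (by simpa using hθ.nat_lt 2) fun a => ?_
  split_ifs <;> assumption

theorem pair_mem_H (hθ : θ.IsRegular) {x y : ZFSet.{u}} (hx : x ∈ H θ) (hy : y ∈ H θ) :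
    ZFSet.pair x y ∈ H θ := by
  refine pair_set_mem_H hθ ?_ (pair_set_mem_H hθ hx hy)
  rw [← ZFSet.pair_eq_singleton]
  exact pair_set_mem_H hθ hx hx

end H

/-! ### Closure under solutions of relations -/

/-- A family `g` of functions into `X` solves the relation `R` pointwise if for any `s` of its
members there is a member which is a solution of `R s` wherever there is a solution. -/
def SolvesPointwise {X : Type*} {ι I : Type*} (R : (ℕ → X) → X → Prop) (g : ι → I → X) : Prop :=
  ∀ s : ℕ → ι, ∃ k, ∀ i, (∃ y, R (fun m => g (s m) i) y) → R (fun m => g (s m) i) (g k i)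

instance countable_setLang_symbols : Countable setLang.Symbols := by
  have : Countable (Σ l, setLang.Functions l) :=
    have : ∀ l, IsEmpty (setLang.Functions l) := fun _ => inferInstanceAs (IsEmpty Empty)
    inferInstance
  have : Countable (Σ l, setLang.Relations l) := by
    have : Subsingleton (Σ l, setLang.Relations l) :=
      ⟨by rintro ⟨_, ⟨⟩⟩ ⟨_, ⟨⟩⟩; rfl⟩
    infer_instance
  exact instCountableSum

section BaseRels

variable (θ : Cardinal.{u})

/-- `y` satisfies the formula `φ` with parameters `s`. -/
def skolemRel (φ : Σ p : ℕ × ℕ, setLang.BoundedFormula (Fin p.1) (p.2 + 1))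
    (s : ℕ → H θ) (y : H θ) : Prop :=
  φ.2.Realize (fun i => s i) (Fin.snoc (fun j : Fin φ.1.2 => s (φ.1.1 + j)) y : Fin _ → H θ)

/-- `b` is the subset of `s 0` that is defined by `φ`. -/
def sepRel (φ : Σ n : ℕ, setLang.Formula (Fin (n + 1))) (s : ℕ → H θ) (b : H θ) : Prop :=
  ∀ x : H θ, x.1 ∈ b.1 ↔ x.1 ∈ (s 0).1 ∧
    φ.2.Realize (Fin.cons x (fun i : Fin φ.1 => s (i + 1)) : Fin (φ.1 + 1) → H θ)

/-- `b` collects witnesses of the formula `φ` for the elements of `s 0`. -/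
def collRel (φ : Σ n : ℕ, setLang.Formula (Fin (n + 2))) (s : ℕ → H θ) (b : H θ) : Prop :=
  ∀ x : H θ, x.1 ∈ (s 0).1 →
    (∃ y : H θ, φ.2.Realize (Fin.cons x (Fin.cons y (fun i : Fin φ.1 => s (i + 1)) :
      Fin (φ.1 + 1) → H θ) : Fin (φ.1 + 2) → H θ)) →
    ∃ y : H θ, y.1 ∈ b.1 ∧ φ.2.Realize (Fin.cons x (Fin.cons y (fun i : Fin φ.1 => s (i + 1)) :
      Fin (φ.1 + 1) → H θ) : Fin (φ.1 + 2) → H θ)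

/-- `y` is an element of `s 0` that witnesses the formula `φ` for `s 1`. -/
def collWitnessRel (φ : Σ n : ℕ, setLang.Formula (Fin (n + 2))) (s : ℕ → H θ) (y : H θ) : Prop :=
  y.1 ∈ (s 0).1 ∧ φ.2.Realize (Fin.cons (s 1) (Fin.cons y (fun i : Fin φ.1 => s (i + 2)) :
      Fin (φ.1 + 1) → H θ) : Fin (φ.1 + 2) → H θ)

/-- `y` is the unordered pair of `s 0` and `s 1`. -/
def pairRel (s : ℕ → H θ) (y : H θ) : Prop := y.1 = {(s 0).1, (s 1).1}

/-- `y` is the union of `s 0`. -/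
def unionRel (s : ℕ → H θ) (y : H θ) : Prop := y.1 = ZFSet.sUnion (s 0).1

/-- `y` is an element of `s 0` that contains `s 1`. -/
def unionWitnessRel (s : ℕ → H θ) (y : H θ) : Prop := y.1 ∈ (s 0).1 ∧ (s 1).1 ∈ y.1

/-- `y` distinguishes `s 0` from `s 1`. -/
def diffRel (s : ℕ → H θ) (y : H θ) : Prop := ¬ (y.1 ∈ (s 0).1 ↔ y.1 ∈ (s 1).1)

/-- `y` is the intersection of `s 0` and `s 1`. -/
def interRel (s : ℕ → H θ) (y : H θ) : Prop := y.1 = (s 0).1 ∩ (s 1).1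

/-- `r` is a well-order of `s 0`. -/
def wellOrderRel (s : ℕ → H θ) (r : H θ) : Prop :=
  ∀ x y : ZFSet.{u}, ZFSet.pair x y ∈ r.1 ↔
    x ∈ (s 0).1 ∧ y ∈ (s 0).1 ∧ ¬ WellOrderingRel y x

/-- The countably many relations on `H(θ)` whose solutions make a subset of `H(θ)` an elementary
submodel and a model of `ZFC⁻`. -/
def baseRels : Set ((ℕ → H θ) → H θ → Prop) :=
  range (skolemRel θ) ∪ range (sepRel θ) ∪ range (collRel θ) ∪ range (collWitnessRel θ) ∪
    {pairRel θ, unionRel θ, unionWitnessRel θ, diffRel θ, interRel θ, wellOrderRel θ}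

theorem countable_baseRels : (baseRels θ).Countable := by
  have : Countable (Σ p : ℕ × ℕ, setLang.BoundedFormula (Fin p.1) (p.2 + 1)) := by
    refine Function.Injective.countable (β := Σ n : ℕ, Σ m : ℕ, setLang.BoundedFormula (Fin n) m)
      (f := fun φ => ⟨φ.1.1, φ.1.2 + 1, φ.2⟩) ?_
    rintro ⟨⟨n, m⟩, φ⟩ ⟨⟨n', m'⟩, φ'⟩ h
    simp only [Sigma.mk.injEq] at h
    obtain ⟨rfl, h⟩ := h
    simp only [heq_eq_eq, Sigma.mk.injEq, Nat.add_right_cancel_iff] at h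
    obtain ⟨rfl, h⟩ := h
    simpa using h
  unfold baseRels
  refine ((((countable_range _).union (countable_range _)).union (countable_range _)).union
    (countable_range _)).union (Set.Finite.countable (by simp))

end BaseRels

/-! ### Łoś's theorem -/

theorem exists_eq_var {α : Type*} (t : setLang.Term α) : ∃ x, t = .var x := by
  cases t with
  | var x => exact ⟨x, rfl⟩
  | func f _ => exact f.elim

/-- Łoś's theorem for the structure `N` that is named by a family `g` of functions into `S`,
provided that the family solves Skolem problems pointwise. -/
theorem realize_iff_eventually {I : Type*} (U : Ultrafilter I) {S N : Set ZFSet.{u}} {ι : Type*}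
    (g : ι → I → S) (π : ι → N) (hπ : Function.Surjective π)
    (heq : ∀ k l, π k = π l ↔ ∀ᶠ i in (U : Filter I), g k i = g l i)
    (hmem : ∀ k l, (π k).1 ∈ (π l).1 ↔ ∀ᶠ i in (U : Filter I), (g k i).1 ∈ (g l i).1)
    (hsk : ∀ {n m : ℕ} (φ : setLang.BoundedFormula (Fin n) (m + 1)) (v : Fin n → ι)
      (xs : Fin m → ι), ∃ k, ∀ i,
      (∃ y, φ.Realize (fun j => g (v j) i) (Fin.snoc (fun j => g (xs j) i) y : Fin _ → S)) →
      φ.Realize (fun j => g (v j) i) (Fin.snoc (fun j => g (xs j) i) (g k i) : Fin _ → S))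
    {n m : ℕ} (φ : setLang.BoundedFormula (Fin n) m) (v : Fin n → ι) (xs : Fin m → ι) :
    φ.Realize (fun j => π (v j)) (fun j => π (xs j)) ↔
      ∀ᶠ i in (U : Filter I), φ.Realize (fun j => g (v j) i) (fun j => g (xs j) i) := by
  have hvar : ∀ {m : ℕ} (xs : Fin m → ι) (t : setLang.Term (Fin n ⊕ Fin m)), ∃ k,
      t.realize (Sum.elim (fun j => π (v j)) fun j => π (xs j)) = π k ∧
      ∀ i, t.realize (Sum.elim (fun j => g (v j) i) fun j => g (xs j) i) = g k i := by
    intro m xs t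
    obtain ⟨x, rfl⟩ := exists_eq_var t
    rcases x with x | x
    · exact ⟨v x, rfl, fun i => rfl⟩
    · exact ⟨xs x, rfl, fun i => rfl⟩
  induction φ with
  | falsum => simp [BoundedFormula.Realize, U.neBot.ne]
  | equal t₁ t₂ =>
    obtain ⟨k, hk, hk'⟩ := hvar xs t₁
    obtain ⟨l, hl, hl'⟩ := hvar xs t₂
    simp only [BoundedFormula.Realize, hk, hl, hk', hl', heq]
  | rel R ts =>
    cases R
    obtain ⟨k, hk, hk'⟩ := hvar xs (ts 0)
    obtain ⟨l, hl, hl'⟩ := hvar xs (ts 1)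
    simp only [BoundedFormula.Realize]
    change (Subtype.val _ ∈ Subtype.val _) ↔ ∀ᶠ i in (U : Filter I), Subtype.val _ ∈ Subtype.val _
    simp only [hk, hl, hk', hl', hmem]
  | imp φ ψ ihφ ihψ =>
    simp only [BoundedFormula.Realize, ihφ, ihψ, Ultrafilter.eventually_imp]
  | @all m φ ih =>
    have hs : ∀ k i, (fun j => g ((Fin.snoc xs k : Fin _ → ι) j) i) =
        (Fin.snoc (fun j => g (xs j) i) (g k i) : Fin _ → S) := fun k i =>
      Fin.comp_snoc (fun k => g k i) xs k
    have hs' : ∀ k, (fun j => π ((Fin.snoc xs k : Fin _ → ι) j)) =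
        (Fin.snoc (fun j => π (xs j)) (π k) : Fin _ → N) := fun k => Fin.comp_snoc π xs k
    simp only [BoundedFormula.Realize]
    rw [hπ.forall]
    have ih' : ∀ k, _ ↔ _ := fun k => ih (Fin.snoc xs k)
    simp only [hs, hs'] at ih'
    simp only [ih']
    refine ⟨fun h => ?_, fun h k => h.mono fun i hi => hi _⟩
    by_contra hc
    rw [← Ultrafilter.eventually_not] at hc
    -- A member of the family that refutes `φ` wherever this is possible is a counterexample on a
    -- large set.
    obtain ⟨k, hk⟩ := hsk φ.not v xs
    obtain ⟨i, hi, hi'⟩ := (hc.and (h k)).exists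
    simp only [not_forall] at hi
    exact hk i hi hi'

theorem formula_realize_iff_eventually {I : Type*} (U : Ultrafilter I) {S N : Set ZFSet.{u}}
    {ι : Type*} (g : ι → I → S) (π : ι → N) (hπ : Function.Surjective π)
    (heq : ∀ k l, π k = π l ↔ ∀ᶠ i in (U : Filter I), g k i = g l i)
    (hmem : ∀ k l, (π k).1 ∈ (π l).1 ↔ ∀ᶠ i in (U : Filter I), (g k i).1 ∈ (g l i).1)
    (hsk : ∀ {n m : ℕ} (φ : setLang.BoundedFormula (Fin n) (m + 1)) (v : Fin n → ι)
      (xs : Fin m → ι), ∃ k, ∀ i,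
      (∃ y, φ.Realize (fun j => g (v j) i) (Fin.snoc (fun j => g (xs j) i) y : Fin _ → S)) →
      φ.Realize (fun j => g (v j) i) (Fin.snoc (fun j => g (xs j) i) (g k i) : Fin _ → S))
    {n : ℕ} (φ : setLang.Formula (Fin n)) (v : Fin n → ι) :
    φ.Realize (fun j => π (v j)) ↔ ∀ᶠ i in (U : Filter I), φ.Realize fun j => g (v j) i := by
  have := realize_iff_eventually U g π hπ heq hmem hsk φ v Fin.elim0
  rw [Subsingleton.elim (fun j => π ((Fin.elim0 : Fin 0 → ι) j)) default] at this
  refine this.trans (Filter.eventually_congr (.of_forall fun i => ?_))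
  rw [Subsingleton.elim (fun j => g ((Fin.elim0 : Fin 0 → ι) j) i) default]
  rfl

theorem SolvesPointwise.exists_skolem {θ : Cardinal.{u}} {ι I : Type*} [Nonempty ι]
    {g : ι → I → H θ} (hg : ∀ R ∈ baseRels θ, SolvesPointwise R g) {n m : ℕ}
    (φ : setLang.BoundedFormula (Fin n) (m + 1)) (v : Fin n → ι) (xs : Fin m → ι) : ∃ k, ∀ i,
      (∃ y, φ.Realize (fun j => g (v j) i) (Fin.snoc (fun j => g (xs j) i) y : Fin _ → H θ)) →
      φ.Realize (fun j => g (v j) i) (Fin.snoc (fun j => g (xs j) i) (g k i) : Fin _ → H θ) := by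
  have hR : skolemRel θ ⟨(n, m), φ⟩ ∈ baseRels θ := by simp [baseRels]
  -- `skolemRel` reads the free variables from the first `n` places and the bound ones from the next
  -- `m`; the remaining places do not matter.
  have := hg _ hR fun i => if h : i < n then v ⟨i, h⟩ else
    if h : i - n < m then xs ⟨i - n, h⟩ else Classical.arbitrary ι
  simpa [skolemRel] using this

/-- `M ⊆ H(θ)` contains solutions of all solvable instances of the relations in `baseRels θ`. -/
structure IsSolutionClosed (θ : Cardinal.{u}) (M : ZFSet.{u}) : Prop where
  subset : ∀ x ∈ M, x ∈ H θ
  solve : ∀ R ∈ baseRels θ, ∀ s : ℕ → H θ, (∀ n, (s n).1 ∈ M) → (∃ y, R s y) → ∃ y, y.1 ∈ M ∧ R s y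

/-- Extension of a nonempty finite sequence to an infinite one. -/
def extendSeq {X : Type*} {n : ℕ} (v : Fin (n + 1) → X) (i : ℕ) : X :=
  if h : i < n + 1 then v ⟨i, h⟩ else v 0

theorem extendSeq_mem {X : Type*} {n : ℕ} {v : Fin (n + 1) → X} {P : X → Prop}
    (h : ∀ i, P (v i)) (i : ℕ) : P (extendSeq v i) := by
  unfold extendSeq
  split_ifs <;> exact h _

theorem extendSeq_zero {X : Type*} {n : ℕ} (v : Fin (n + 1) → X) : extendSeq v 0 = v 0 := by
  simp [extendSeq]

theorem extendSeq_succ {X : Type*} {n : ℕ} (v : Fin (n + 1) → X) (i : Fin n) :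
    extendSeq v (i + 1) = v i.succ := by
  simp [extendSeq, Fin.succ]

theorem extendSeq_one {X : Type*} {n : ℕ} (v : Fin (n + 2) → X) : extendSeq v 1 = v 1 :=
  extendSeq_succ v 0

theorem extendSeq_add_two {X : Type*} {n : ℕ} (v : Fin (n + 2) → X) (i : Fin n) :
    extendSeq v (i + 2) = v i.succ.succ :=
  extendSeq_succ v i.succ

/-! ### Solution-closed sets are elementary submodels and models of `ZFC⁻`. -/

namespace IsSolutionClosed

variable {θ : Cardinal.{u}} {M : ZFSet.{u}}

theorem exists_mem (hM : IsSolutionClosed θ M) {R : (ℕ → H θ) → H θ → Prop} (hR : R ∈ baseRels θ)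
    {n : ℕ} (v : Fin (n + 1) → H θ) (hv : ∀ i, (v i).1 ∈ M) (h : ∃ y, R (extendSeq v) y) :
    ∃ y, y.1 ∈ M ∧ R (extendSeq v) y :=
  hM.solve R hR _ (extendSeq_mem (P := fun x : H θ => x.1 ∈ M) hv) h

/-- The Tarski–Vaught test, obtained as Łoś's theorem for constant functions on a one-point index
set. -/
theorem isElementarySubmodel (hM : IsSolutionClosed θ M) (hne : (M : Set ZFSet.{u}).Nonempty) :
    IsElementarySubmodel (M : Set ZFSet.{u}) (H θ) := by
  refine ⟨hM.subset, fun n φ x => ?_⟩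
  have : Nonempty (M : Set ZFSet.{u}) := hne.to_subtype
  have hg : ∀ R ∈ baseRels θ, SolvesPointwise R
      (fun (k : (M : Set ZFSet.{u})) (_ : Unit) => Set.inclusion hM.subset k) := by
    intro R hR s
    by_cases h : ∃ y, R (fun m => Set.inclusion hM.subset (s m)) y
    · obtain ⟨y, hy, hy'⟩ := hM.solve R hR _ (fun n => (s n).2) h
      exact ⟨⟨y, hy⟩, fun _ _ => hy'⟩
    · exact ⟨Classical.arbitrary _, fun _ h' => (h h').elim⟩
  have := formula_realize_iff_eventually (pure () : Ultrafilter Unit)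
    (fun (k : (M : Set ZFSet.{u})) (_ : Unit) => Set.inclusion hM.subset k) id
    Function.surjective_id
    (fun k l => by
      rw [Ultrafilter.coe_pure, Filter.eventually_pure, Set.inclusion_inj hM.subset, id, id])
    (fun k l => by rw [Ultrafilter.coe_pure, Filter.eventually_pure]; rfl)
    (SolvesPointwise.exists_skolem hg) φ x
  rw [Ultrafilter.coe_pure, Filter.eventually_pure] at this
  exact this.symm

variable (hM : IsSolutionClosed θ M)
include hM

theorem pair_set_mem (hθ : θ.IsRegular) {x y : ZFSet.{u}} (hx : x ∈ M) (hy : y ∈ M) :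
    ({x, y} : ZFSet) ∈ M := by
  obtain ⟨z, hz, hz'⟩ := hM.exists_mem (R := pairRel θ) (by simp [baseRels])
    ![⟨x, hM.subset x hx⟩, ⟨y, hM.subset y hy⟩] (by simp [Fin.forall_fin_two, hx, hy])
    ⟨⟨_, pair_set_mem_H hθ (hM.subset x hx) (hM.subset y hy)⟩, by simp [pairRel, extendSeq_zero, extendSeq_one]⟩
  simp only [pairRel, extendSeq_zero, extendSeq_one, Matrix.cons_val_zero,
    Matrix.cons_val_one] at hz'
  exact hz' ▸ hz

theorem pair_mem (hθ : θ.IsRegular) {x y : ZFSet.{u}} (hx : x ∈ M) (hy : y ∈ M) :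
    ZFSet.pair x y ∈ M := by
  refine hM.pair_set_mem hθ ?_ (hM.pair_set_mem hθ hx hy)
  rw [← ZFSet.pair_eq_singleton]
  exact hM.pair_set_mem hθ hx hx

/-- `M` need not be transitive, so a difference might be visible only outside `M`; `diffRel`
supplies one inside. -/
theorem ext {x y : ZFSet.{u}} (hx : x ∈ M) (hy : y ∈ M) (h : ∀ z ∈ M, z ∈ x ↔ z ∈ y) : x = y := by
  by_contra hne
  have : ∃ z, ¬ (z ∈ x ↔ z ∈ y) := by
    by_contra! h'
    exact hne (ZFSet.ext h')
  obtain ⟨z, hz⟩ := this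
  have hzH : z ∈ H θ := by
    by_cases hzx : z ∈ x
    · exact mem_H_of_mem (hM.subset x hx) hzx
    · exact mem_H_of_mem (hM.subset y hy) (by tauto)
  obtain ⟨w, hw, hw'⟩ := hM.exists_mem (R := diffRel θ) (by simp [baseRels])
    ![⟨x, hM.subset x hx⟩, ⟨y, hM.subset y hy⟩] (by simp [Fin.forall_fin_two, hx, hy])
    ⟨⟨z, hzH⟩, by
      simpa only [diffRel, extendSeq_zero, extendSeq_one, Matrix.cons_val_zero,
        Matrix.cons_val_one] using hz⟩
  simp only [diffRel, extendSeq_zero, extendSeq_one, Matrix.cons_val_zero,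
    Matrix.cons_val_one] at hw'
  exact hw' (h w.1 hw)

theorem isPairIn_iff (hθ : θ.IsRegular) (p x y : (M : Set ZFSet.{u})) :
    IsPairIn (M : Set ZFSet.{u}) p x y ↔ p.1 = ZFSet.pair x.1 y.1 := by
  have h1 : ∀ z : (M : Set ZFSet.{u}),
      (∀ t : (M : Set ZFSet.{u}), t.1 ∈ z.1 ↔ t = x) ↔ z.1 = {x.1} := fun z => by
    refine ⟨fun h => hM.ext z.2 ?_ fun t ht => ?_, fun h t => by rw [h, ZFSet.mem_singleton, Subtype.ext_iff]⟩
    · rw [← ZFSet.pair_eq_singleton]; exact hM.pair_set_mem hθ x.2 x.2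
    · simpa [Subtype.ext_iff] using h ⟨t, ht⟩
  have h2 : ∀ z : (M : Set ZFSet.{u}),
      (∀ t : (M : Set ZFSet.{u}), t.1 ∈ z.1 ↔ t = x ∨ t = y) ↔ z.1 = {x.1, y.1} := fun z => by
    refine ⟨fun h => hM.ext z.2 (hM.pair_set_mem hθ x.2 y.2) fun t ht => ?_,
      fun h t => by rw [h, ZFSet.mem_pair, Subtype.ext_iff, Subtype.ext_iff]⟩
    simpa [Subtype.ext_iff] using h ⟨t, ht⟩
  simp only [IsPairIn, h1, h2]
  refine ⟨fun h => hM.ext p.2 (hM.pair_mem hθ x.2 y.2) fun z hz => ?_, fun h z => ?_⟩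
  · simpa [ZFSet.pair] using h ⟨z, hz⟩
  · simp [h, ZFSet.pair]

theorem separation (hne : (M : Set ZFSet.{u}).Nonempty)
    (n : ℕ) (φ : setLang.Formula (Fin (n + 1))) (p : Fin n → (M : Set ZFSet.{u}))
    (a : (M : Set ZFSet.{u})) : ∃ b : (M : Set ZFSet.{u}), ∀ x : (M : Set ZFSet.{u}),
      x.1 ∈ b.1 ↔ x.1 ∈ a.1 ∧ φ.Realize (Fin.cons x p : Fin (n + 1) → (M : Set ZFSet.{u})) := by
  obtain ⟨hsub, hel⟩ := hM.isElementarySubmodel hne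
  obtain ⟨b, hb, hb'⟩ := hM.exists_mem (R := sepRel θ ⟨n, φ⟩) (by simp [baseRels])
    (Fin.cons (inclusion hsub a) (inclusion hsub ∘ p) : Fin (n + 1) → H θ)
    (Fin.cases a.2 fun i => (p i).2)
    ⟨⟨ZFSet.sep (fun x => ∃ h : x ∈ H θ, φ.Realize
        (Fin.cons ⟨x, h⟩ (inclusion hsub ∘ p) : Fin (n + 1) → H θ)) a.1,
      mem_H_of_subset (hM.subset _ a.2) ZFSet.sep_subset⟩, fun x => by
        simp [extendSeq_zero, extendSeq_succ, Function.comp_def]⟩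
  refine ⟨⟨b, hb⟩, fun x => ?_⟩
  rw [← hel φ (Fin.cons x p), hb' (inclusion hsub x), Fin.comp_cons]
  simp [extendSeq_zero, extendSeq_succ, Function.comp_def]

theorem collection (hθ : θ.IsRegular) (hne : (M : Set ZFSet.{u}).Nonempty)
    (n : ℕ) (φ : setLang.Formula (Fin (n + 2))) (p : Fin n → (M : Set ZFSet.{u}))
    (a : (M : Set ZFSet.{u}))
    (h : ∀ x : (M : Set ZFSet.{u}), x.1 ∈ a.1 → ∃ y : (M : Set ZFSet.{u}),
      φ.Realize (Fin.cons x (Fin.cons y p : Fin (n + 1) → _) : Fin (n + 2) → _)) :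
    ∃ b : (M : Set ZFSet.{u}), ∀ x : (M : Set ZFSet.{u}), x.1 ∈ a.1 →
      ∃ y : (M : Set ZFSet.{u}), y.1 ∈ b.1 ∧
        φ.Realize (Fin.cons x (Fin.cons y p : Fin (n + 1) → _) : Fin (n + 2) → _) := by
  obtain ⟨hsub, hel⟩ := hM.isElementarySubmodel hne
  have hex : ∃ b : H θ, collRel θ ⟨n, φ⟩
      (extendSeq (Fin.cons (inclusion hsub a) (inclusion hsub ∘ p) : Fin (n + 1) → H θ)) b := by
    let Q : H θ → H θ → Prop := fun x y => φ.Realize (Fin.cons x (Fin.cons y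
      (inclusion hsub ∘ p) : Fin (n + 1) → H θ) : Fin (n + 2) → H θ)
    have hF : ∀ x, ∃ y, (∃ z, Q x z) → Q x y := fun x => by
      by_cases h : ∃ z, Q x z
      · exact ⟨h.choose, fun _ => h.choose_spec⟩
      · exact ⟨x, fun h' => (h h').elim⟩
    choose F hF using hF
    let e : Shrink.{u} a.1 → H θ := fun i =>
      ⟨((equivShrink a.1).symm i).1, mem_H_of_mem (hM.subset _ a.2) (Subtype.prop _)⟩
    refine ⟨⟨ZFSet.range fun i => (F (e i)).1,
      range_mem_H hθ (card_lt_of_mem_H (hM.subset _ a.2)) fun i => (F (e i)).2⟩, fun x hx hy => ?_⟩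
    simp only [extendSeq_zero, extendSeq_succ, Fin.cons_succ, Fin.cons_zero] at hx hy ⊢
    refine ⟨F x, ZFSet.mem_range.2 ⟨equivShrink a.1 ⟨x.1, hx⟩, ?_⟩, hF x hy⟩
    simp [e]
  obtain ⟨b, hb, hb'⟩ := hM.exists_mem (by simp [baseRels]) _ (Fin.cases a.2 fun i => (p i).2) hex
  refine ⟨⟨b, hb⟩, fun x hx => ?_⟩
  obtain ⟨y, hy⟩ := h x hx
  rw [← hel] at hy
  simp only [Fin.comp_cons] at hy
  obtain ⟨z, hz, hz'⟩ := hb' (inclusion hsub x) (by simpa [extendSeq_zero] using hx)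
    ⟨inclusion hsub y, by
      simpa [extendSeq_succ, Function.comp_def] using hy⟩
  simp only [extendSeq_succ, Fin.cons_succ] at hz'
  -- The witness `z` in `b` may lie outside `M`; `collWitnessRel` replaces it by one in `M`.
  obtain ⟨w, hw, hw'⟩ := hM.exists_mem (R := collWitnessRel θ ⟨n, φ⟩) (by simp [baseRels])
    (Fin.cons b (Fin.cons (inclusion hsub x) (inclusion hsub ∘ p)) : Fin (n + 2) → H θ)
    (Fin.cases hb (Fin.cases x.2 fun i => (p i).2))
    ⟨z, by
      refine ⟨by simpa [extendSeq_zero] using hz, ?_⟩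
      simpa [extendSeq_one, extendSeq_add_two] using hz'⟩
  refine ⟨⟨w, hw⟩, by simpa [extendSeq_zero] using hw'.1, ?_⟩
  rw [← hel]
  simp only [Fin.comp_cons]
  simpa [extendSeq_one, extendSeq_add_two, Function.comp_def] using hw'.2

theorem modelsZFCMinus (hθ : θ.IsRegular) (o : Ordinal.{u}) (ho : Order.IsSuccLimit o)
    (hsub : (o + 1).toZFSet ⊆ M) : ModelsZFCMinus (M : Set ZFSet.{u}) := by
  have hoM : o.toZFSet ∈ M := hsub (Ordinal.toZFSet_mem_toZFSet_iff.2 (Order.lt_succ o))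
  have hoM' : ∀ a < o, a.toZFSet ∈ M := fun a ha =>
    hsub (Ordinal.toZFSet_mem_toZFSet_iff.2 (ha.trans (Order.lt_succ o)))
  have hne : (M : Set ZFSet.{u}).Nonempty := ⟨_, hoM⟩
  refine ⟨fun a b h => Subtype.ext (hM.ext a.2 b.2 fun z hz => h ⟨z, hz⟩), ?_, ?_, ?_, ?_,
    hM.separation hne, hM.collection hθ hne, ?_⟩
  · rintro a ⟨x, hx⟩
    -- Minimality is needed only among elements of `M`, so the minimum is taken in `a ∩ M`.
    obtain ⟨y, hy, hy'⟩ := ZFSet.mem_wf.has_min {y | y ∈ a.1 ∧ y ∈ M} ⟨x.1, hx, x.2⟩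
    exact ⟨⟨y, hy.2⟩, hy.1, fun z hz hza => hy' z.1 ⟨hza, z.2⟩ hz⟩
  · intro a b
    exact ⟨⟨_, hM.pair_set_mem hθ a.2 b.2⟩, fun x => by
      rw [ZFSet.mem_pair, Subtype.ext_iff, Subtype.ext_iff]⟩
  · intro a
    obtain ⟨b, hb, hb'⟩ := hM.exists_mem (R := unionRel θ) (by simp [baseRels])
      ![⟨a.1, hM.subset _ a.2⟩] (by simp)
      ⟨⟨_, sUnion_mem_H (hM.subset _ a.2)⟩, by simp [unionRel, extendSeq_zero]⟩
    simp only [unionRel, extendSeq_zero, Matrix.cons_val_zero] at hb'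
    refine ⟨⟨b.1, hb⟩, fun x => ?_⟩
    simp only [hb', ZFSet.mem_sUnion]
    constructor
    · rintro ⟨z, hz, hxz⟩
      obtain ⟨y, hy, hy'⟩ := hM.exists_mem (R := unionWitnessRel θ) (by simp [baseRels])
        ![⟨a.1, hM.subset _ a.2⟩, ⟨x.1, hM.subset _ x.2⟩] (by simp [Fin.forall_fin_two])
        ⟨⟨z, mem_H_of_mem (hM.subset _ a.2) hz⟩, by
          simpa only [unionWitnessRel, extendSeq_zero, extendSeq_one, Matrix.cons_val_zero,
            Matrix.cons_val_one] using ⟨hz, hxz⟩⟩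
      exact ⟨⟨y.1, hy⟩, by
        simpa only [unionWitnessRel, extendSeq_zero, extendSeq_one, Matrix.cons_val_zero,
          Matrix.cons_val_one] using hy'⟩
    · rintro ⟨y, hy, hxy⟩
      exact ⟨y.1, hy, hxy⟩
  · refine ⟨⟨_, hoM⟩, ⟨⟨(0 : Ordinal).toZFSet, hoM' 0 ho.bot_lt⟩,
      Ordinal.toZFSet_mem_toZFSet_iff.2 ho.bot_lt, by simp⟩, fun x hx => ?_⟩
    obtain ⟨a, ha, hax⟩ := Ordinal.mem_toZFSet_iff.1 hx
    refine ⟨⟨(a + 1).toZFSet, hoM' _ (ho.succ_lt ha)⟩,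
      Ordinal.toZFSet_mem_toZFSet_iff.2 (ho.succ_lt ha), fun z => ?_⟩
    change z.1 ∈ (a + 1).toZFSet ↔ _
    rw [Ordinal.toZFSet_add_one, hax, ZFSet.mem_insert_iff, or_comm, Subtype.ext_iff]
  · intro a
    -- The order is the reflexive form of a global well-order of all sets, restricted to `a`.
    have hex : ∃ r : H θ, wellOrderRel θ (extendSeq ![⟨a.1, hM.subset _ a.2⟩]) r := by
      let D := {p : Shrink.{u} a.1 × Shrink.{u} a.1 //
        ¬ WellOrderingRel ((equivShrink a.1).symm p.2).1 ((equivShrink a.1).symm p.1).1}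
      have hD : #D < θ := by
        refine (mk_subtype_le _).trans_lt ?_
        have := card_lt_of_mem_H (hM.subset _ a.2)
        rw [← mul_def]
        exact mul_lt_of_lt hθ.aleph0_le this this
      refine ⟨⟨ZFSet.range fun p : D => ZFSet.pair ((equivShrink a.1).symm p.1.1).1
        ((equivShrink a.1).symm p.1.2).1, range_mem_H hθ hD fun p => ?_⟩, fun x y => ?_⟩
      · exact pair_mem_H hθ (mem_H_of_mem (hM.subset _ a.2) (Subtype.prop _))
          (mem_H_of_mem (hM.subset _ a.2) (Subtype.prop _))
      · simp only [ZFSet.mem_range, ZFSet.pair_inj, extendSeq_zero, Matrix.cons_val_zero]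
        constructor
        · rintro ⟨p, rfl, rfl⟩
          exact ⟨Subtype.prop _, Subtype.prop _, p.2⟩
        · rintro ⟨hx, hy, hxy⟩
          exact ⟨⟨(equivShrink a.1 ⟨x, hx⟩, equivShrink a.1 ⟨y, hy⟩), by simpa using hxy⟩, by simp⟩
    obtain ⟨r, hr, hr'⟩ := hM.exists_mem (by simp [baseRels]) _ (by simp) hex
    simp only [wellOrderRel, extendSeq_zero, Matrix.cons_val_zero] at hr'
    have key : ∀ x y : (M : Set ZFSet.{u}),
        (∃ p : (M : Set ZFSet.{u}), p.1 ∈ r.1 ∧ IsPairIn (M : Set ZFSet.{u}) p x y) ↔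
        x.1 ∈ a.1 ∧ y.1 ∈ a.1 ∧ ¬ WellOrderingRel y.1 x.1 := fun x y => by
      rw [← hr']
      constructor
      · rintro ⟨p, hp, hpair⟩
        rwa [(hM.isPairIn_iff hθ p x y).1 hpair] at hp
      · exact fun h => ⟨⟨_, hM.pair_mem hθ x.2 y.2⟩, h, (hM.isPairIn_iff hθ _ x y).2 rfl⟩
    refine ⟨⟨r.1, hr⟩, ?_⟩
    simp only [key]
    refine ⟨fun x y _ _ h1 h2 => ?_, fun x y z hx hy hz h1 h2 => ⟨hx, hz, fun h => ?_⟩,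
      fun b hb hbne => ?_⟩
    · rcases trichotomous_of WellOrderingRel x.1 y.1 with h | h | h
      · exact (h2.2.2 h).elim
      · exact Subtype.ext h
      · exact (h1.2.2 h).elim
    · rcases trichotomous_of WellOrderingRel x.1 y.1 with h' | h' | h'
      · exact h2.2.2 (_root_.trans h h')
      · exact h2.2.2 (h' ▸ h)
      · exact h1.2.2 h'
    · obtain ⟨x, hx⟩ := hbne
      obtain ⟨y, hy, hmin⟩ := (IsWellFounded.wf (r := WellOrderingRel (α := ZFSet.{u}))).has_min
        {y | y ∈ b.1 ∧ y ∈ M} ⟨x.1, hx, x.2⟩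
      exact ⟨⟨y, hy.2⟩, hy.1, fun z hz =>
        ⟨hb ⟨y, hy.2⟩ hy.1, hb z hz, hmin z.1 ⟨hz, z.2⟩⟩⟩

theorem isWeakModel (hθ : θ.IsRegular) {lam : Cardinal.{u}} (hlam : ℵ₀ ≤ lam) (hcard : M.card ≤ lam)
    (hsub : (lam.ord + 1).toZFSet ⊆ M) : IsWeakModel lam M := by
  refine ⟨hcard.antisymm ?_, hsub, hM.modelsZFCMinus hθ _ (isSuccLimit_ord hlam) hsub⟩
  have : lam.ord.toZFSet ⊆ M := fun x hx =>
    hsub (Ordinal.toZFSet_monotone (Order.le_succ lam.ord) hx)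
  simpa using ZFSet.card_mono this

end IsSolutionClosed

/-! ### Collapsing a family of functions, and powerset preserving embeddings. -/

/-- The formula `x ∈ y`. -/
def memFormula : setLang.Formula (Fin 2) :=
  FirstOrder.Language.Relations.formula₂ (L := setLang) (SetRel.mem : setLang.Relations 2)
    (.var 0) (.var 1)

/-- The Mostowski collapse of the structure of functions `g k` modulo a countably complete
ultrafilter. -/
theorem exists_collapse {I : Type*} (U : Ultrafilter I) [CountableInterFilter (U : Filter I)]
    {θ : Cardinal.{u}} {ι : Type u} (g : ι → I → H θ)
    (hg : ∀ R ∈ baseRels θ, SolvesPointwise R g) :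
    ∃ N : ZFSet.{u}, N.IsTransitive ∧ ∃ π : ι → (N : Set ZFSet.{u}), Function.Surjective π ∧
      (∀ k l, π k = π l ↔ ∀ᶠ i in (U : Filter I), g k i = g l i) ∧
      (∀ k l, (π k).1 ∈ (π l).1 ↔ ∀ᶠ i in (U : Filter I), (g k i).1 ∈ (g l i).1) := by
  let E : ι → ι → Prop := fun k l => ∀ᶠ i in (U : Filter I), (g k i).1 ∈ (g l i).1
  have wf : WellFounded E := by
    rw [wellFounded_iff_isEmpty_descending_chain]
    refine ⟨fun ⟨s, hs⟩ => ?_⟩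
    obtain ⟨i, hi⟩ := (eventually_countable_forall.2 hs).exists
    exact (wellFounded_iff_isEmpty_descending_chain.1 ZFSet.mem_wf).false ⟨fun n => (g (s n) i).1, hi⟩
  let p : ι → ZFSet.{u} := wf.fix fun l f => ZFSet.range fun k : {k // E k l} => f k.1 k.2
  have hp : ∀ l x, x ∈ p l ↔ ∃ k, E k l ∧ p k = x := fun l x => by
    have : p l = ZFSet.range fun k : {k // E k l} => p k.1 := wf.fix_eq _ l
    rw [this, ZFSet.mem_range]
    simp
  have hcongr : ∀ {k k' l}, (∀ᶠ i in (U : Filter I), g k i = g k' i) → E k l → E k' l :=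
    fun h h' => by filter_upwards [h, h'] with i hi hi'; rwa [← hi]
  have heq : ∀ k l, p k = p l ↔ ∀ᶠ i in (U : Filter I), g k i = g l i := by
    intro k l
    constructor
    · induction k using wf.induction generalizing l with
      | _ k ih =>
      intro hkl
      by_contra hne
      rw [← Ultrafilter.eventually_not] at hne
      -- Extensionality modulo `U`: the family has a member `d` that distinguishes `g k i` from `g l
      -- i` wherever they differ.
      obtain ⟨d, hd⟩ := hg (diffRel θ) (by simp [baseRels]) fun n => if n = 0 then k else l
      simp only [diffRel, if_true, one_ne_zero, if_false] at hd
      have hd' : ¬ (E d k ↔ E d l) := by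
        have hdiff : ∀ᶠ i in (U : Filter I), ¬ ((g d i).1 ∈ (g k i).1 ↔ (g d i).1 ∈ (g l i).1) := by
          filter_upwards [hne] with i hi
          refine hd i ?_
          by_contra! hc
          refine hi (Subtype.ext (ZFSet.ext fun z => ⟨fun hz => ?_, fun hz => ?_⟩))
          · exact (hc ⟨z, mem_H_of_mem (g k i).2 hz⟩).1 hz
          · exact (hc ⟨z, mem_H_of_mem (g l i).2 hz⟩).2 hz
        intro hiff
        by_cases hk : E d k
        · obtain ⟨i, hi, h1, h2⟩ := (hdiff.and (hk.and (hiff.1 hk))).exists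
          exact hi (iff_of_true h1 h2)
        · have hl := fun h => hk (hiff.2 h)
          obtain ⟨i, hi, h1, h2⟩ := (hdiff.and ((Ultrafilter.eventually_not.2 hk).and
            (Ultrafilter.eventually_not.2 hl))).exists
          exact hi (iff_of_false h1 h2)
      refine hd' ⟨fun hdk => ?_, fun hdl => ?_⟩
      · obtain ⟨d', hd'l, he⟩ := (hp l _).1 (hkl ▸ (hp k _).2 ⟨d, hdk, rfl⟩)
        exact hcongr ((ih d hdk d' he.symm).mono fun _ => Eq.symm) hd'l
      · obtain ⟨d', hd'k, he⟩ := (hp k _).1 (hkl ▸ (hp l _).2 ⟨d, hdl, rfl⟩)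
        exact hcongr (ih d' hd'k d he) hd'k
    · intro h
      ext x
      rw [hp, hp]
      have : ∀ m, E m k ↔ E m l := fun m => Filter.eventually_congr (by
        filter_upwards [h] with i hi; rw [hi])
      simp only [this]
  refine ⟨ZFSet.range p, ?_, fun k => ⟨p k, ZFSet.mem_range_self k⟩, ?_, ?_, ?_⟩
  · intro x hx y hy
    obtain ⟨l, rfl⟩ := ZFSet.mem_range.1 hx
    obtain ⟨k, -, rfl⟩ := (hp l y).1 hy
    exact ZFSet.mem_range_self k
  · rintro ⟨x, hx⟩
    obtain ⟨l, rfl⟩ := ZFSet.mem_range.1 hx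
    exact ⟨l, rfl⟩
  · exact fun k l => Subtype.ext_iff.trans (heq k l)
  · intro k l
    refine (hp l (p k)).trans ⟨?_, fun h => ⟨k, h, rfl⟩⟩
    rintro ⟨k', hk', he⟩
    exact hcongr ((heq k' k).1 he) hk'

/-- A criterion for the existence of a powerset preserving embedding, in terms of a family `g` of
functions modulo an ultrafilter, of which `g c` represents the cardinal `lam`. -/
theorem exists_isPowersetPreserving {I : Type*} (U : Ultrafilter I)
    [CountableInterFilter (U : Filter I)] {θ : Cardinal.{u}} {ι : Type u} (g : ι → I → H θ)
    (hg : ∀ R ∈ baseRels θ, SolvesPointwise R g) {lam : Cardinal.{u}} {M : ZFSet.{u}}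
    (hsub : (lam.ord + 1).toZFSet ⊆ M) (J : ↥(M : Set ZFSet.{u}) → ι)
    (hJ : ∀ ⦃n : ℕ⦄ (φ : setLang.Formula (Fin n)) (x : Fin n → (M : Set ZFSet.{u})),
      φ.Realize x ↔ ∀ᶠ i in (U : Filter I), φ.Realize fun j => g (J (x j)) i)
    (hJ0 : ∀ x : (M : Set ZFSet.{u}), x.1 ∈ lam.ord.toZFSet →
      ∀ᶠ i in (U : Filter I), (g (J x) i).1 = x.1)
    (c : ι) (hc0 : ∀ i, (g c i).1.IsTransitive)
    (hc1 : ∀ γ ∈ lam.ord.toZFSet, ∀ᶠ i in (U : Filter I), γ ∈ (g c i).1)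
    (hc2 : ∀ k, (∀ᶠ i in (U : Filter I), (g k i).1 ∈ (g c i).1) →
      ∃ γ ∈ lam.ord.toZFSet, ∀ᶠ i in (U : Filter I), (g k i).1 = γ)
    (hc3 : ∀ x : (M : Set ZFSet.{u}), x.1 = lam.ord.toZFSet →
      ¬ ∀ᶠ i in (U : Filter I), g (J x) i = g c i)
    (hE : ∀ k, ZFSet.sep (fun γ => ∀ᶠ i in (U : Filter I), γ ∈ (g k i).1) lam.ord.toZFSet ∈ M) :
    ∃ N : ZFSet.{u}, N.IsTransitive ∧
      ∃ j : (M : Set ZFSet.{u}) ↪ₑ[setLang] (N : Set ZFSet.{u}), IsPowersetPreserving lam j := by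
  have : Nonempty ι := ⟨c⟩
  obtain ⟨N, hN, π, hπ, heq, hmem⟩ := exists_collapse U g hg
  have hloe : ∀ {n : ℕ} (φ : setLang.Formula (Fin n)) (v : Fin n → ι),
      φ.Realize (fun j => π (v j)) ↔ ∀ᶠ i in (U : Filter I), φ.Realize fun j => g (v j) i :=
    fun φ v => formula_realize_iff_eventually U g π hπ heq hmem (SolvesPointwise.exists_skolem hg) φ v
  have hJmem : ∀ x y : (M : Set ZFSet.{u}), x.1 ∈ y.1 ↔
      ∀ᶠ i in (U : Filter I), (g (J x) i).1 ∈ (g (J y) i).1 := fun x y =>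
    hJ memFormula ![x, y]
  have htr : lam.ord.toZFSet.IsTransitive := (ZFSet.isOrdinal_toZFSet _).isTransitive
  have hlamM : lam.ord.toZFSet ∈ M := hsub (Ordinal.toZFSet_mem_toZFSet_iff.2 (Order.lt_succ _))
  have hM0 : ∀ {γ}, γ ∈ lam.ord.toZFSet → γ ∈ M := fun h =>
    hsub (Ordinal.toZFSet_monotone (Order.le_succ lam.ord) h)
  have hconst : ∀ {γ} (h : γ ∈ lam.ord.toZFSet) k,
      (∀ᶠ i in (U : Filter I), (g k i).1 = γ) → π k = π (J ⟨γ, hM0 h⟩) := fun h k hk => by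
    rw [heq]
    filter_upwards [hk, hJ0 ⟨_, hM0 h⟩ h] with i hi hi'
    exact Subtype.ext (hi.trans hi'.symm)
  -- By `∈`-induction: anything below `γ` in the collapse is represented below `g c`, so by `hc2` it
  -- is an old element of `lam`.
  have hfix : ∀ γ (h : γ ∈ lam.ord.toZFSet), (π (J ⟨γ, hM0 h⟩)).1 = γ := by
    intro γ
    induction γ using ZFSet.inductionOn with
    | _ γ ih =>
    intro h
    ext y
    constructor
    · intro hy
      obtain ⟨k, hk⟩ := hπ ⟨y, hN _ (π (J ⟨γ, hM0 h⟩)).2 hy⟩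
      have hy' : (π k).1 ∈ (π (J ⟨γ, hM0 h⟩)).1 := by rw [hk]; exact hy
      rw [hmem] at hy'
      have hkγ : ∀ᶠ i in (U : Filter I), (g k i).1 ∈ γ := by
        filter_upwards [hy', hJ0 ⟨_, hM0 h⟩ h] with i hi hi'
        rwa [hi'] at hi
      obtain ⟨δ, hδ, hkδ⟩ := hc2 k (by
        filter_upwards [hkγ, hc1 γ h] with i hi hi'
        exact hc0 i γ hi' hi)
      obtain ⟨i, hi, hi'⟩ := (hkγ.and hkδ).exists
      rw [hi'] at hi
      have := hconst hδ k hkδ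
      rw [hk, Subtype.ext_iff, ih δ hi hδ] at this
      change y = δ at this
      rwa [this]
    · intro hy
      have hy0 := htr γ h hy
      rw [← ih y hy hy0, hmem]
      filter_upwards [hJ0 ⟨_, hM0 h⟩ h, hJ0 ⟨_, hM0 hy0⟩ hy0] with i hi hi'
      rw [hi, hi']; exact hy
  have hmemc : ∀ {k}, (∀ᶠ i in (U : Filter I), (g k i).1 ∈ (g c i).1) →
      ∃ h : (π k).1 ∈ lam.ord.toZFSet, π k = π (J ⟨_, hM0 h⟩) := fun {k} hk => by
    obtain ⟨γ, hγ, h⟩ := hc2 k hk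
    have h1 := hconst hγ k h
    have h2 := congrArg Subtype.val h1
    rw [hfix γ hγ] at h2
    exact ⟨h2 ▸ hγ, by simpa only [h2] using h1⟩
  have hmemγ : ∀ {γ} (h : γ ∈ lam.ord.toZFSet) k, γ ∈ (π k).1 ↔
      ∀ᶠ i in (U : Filter I), γ ∈ (g k i).1 := fun {γ} h k => by
    conv_lhs => rw [← hfix γ h]
    rw [hmem]
    refine eventually_congr ?_
    filter_upwards [hJ0 ⟨_, hM0 h⟩ h] with i hi
    rw [hi]
  have hπc : (π c).1 = lam.ord.toZFSet := by
    ext y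
    refine ⟨fun hy => ?_, fun hy => (hmemγ hy c).2 (hc1 y hy)⟩
    obtain ⟨k, hk⟩ := hπ ⟨y, hN _ (π c).2 hy⟩
    have hy' : (π k).1 ∈ (π c).1 := by rw [hk]; exact hy
    obtain ⟨h, -⟩ := hmemc ((hmem _ _).1 hy')
    rwa [hk] at h
  refine ⟨N, hN, ⟨fun x => π (J x), fun n φ x => ?_⟩, fun x hx => hfix x.1 hx,
    ⟨⟨_, hlamM⟩, rfl, fun h => ?_⟩, fun X hX => ⟨fun hXM => ?_, fun hXN => ?_⟩⟩
  · exact (hloe φ fun j => J (x j)).trans (hJ φ x).symm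
  · exact hc3 ⟨_, hlamM⟩ rfl ((heq _ _).1 (Subtype.ext (h.trans hπc.symm)))
  -- `X` is `j(X) ∩ lam`, which is represented by the pointwise intersection of `J X` and `c`.
  · obtain ⟨d, hd⟩ := hg (interRel θ) (by simp [baseRels]) fun n => if n = 0 then J ⟨X, hXM⟩ else c
    simp only [interRel, if_true, one_ne_zero, if_false] at hd
    have hd' := fun i => hd i ⟨⟨_, mem_H_of_subset (g c i).2 fun z hz =>
      (ZFSet.mem_inter.1 hz).2⟩, rfl⟩
    have hXγ : ∀ {γ}, γ ∈ lam.ord.toZFSet → (γ ∈ X ↔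
        ∀ᶠ i in (U : Filter I), γ ∈ (g (J ⟨X, hXM⟩) i).1) := fun {γ} h => by
      refine (hJmem ⟨γ, hM0 h⟩ ⟨X, hXM⟩).trans (eventually_congr ?_)
      filter_upwards [hJ0 ⟨_, hM0 h⟩ h] with i hi
      rw [hi]
    suffices hXd : X = (π d).1 by rw [hXd]; exact (π d).2
    ext y
    refine ⟨fun hy => ?_, fun hy => ?_⟩
    · rw [hmemγ (hX hy)]
      filter_upwards [(hXγ (hX hy)).1 hy, hc1 y (hX hy)] with i hi hi'
      rw [hd']
      exact ZFSet.mem_inter.2 ⟨hi, hi'⟩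
    · obtain ⟨k, hk⟩ := hπ ⟨y, hN _ (π d).2 hy⟩
      have hy' : (π k).1 ∈ (π d).1 := by rw [hk]; exact hy
      rw [hmem] at hy'
      obtain ⟨h, -⟩ := hmemc (k := k) (hy'.mono fun i hi => by
        rw [hd'] at hi; exact (ZFSet.mem_inter.1 hi).2)
      rw [hk] at h
      rw [hXγ h]
      filter_upwards [(hmemγ h d).1 hy] with i hi
      rw [hd'] at hi
      exact (ZFSet.mem_inter.1 hi).1
  -- If `k` represents `X`, then `X` is the set of those `γ` below `lam` that are almost always in
  -- `g k i`, and `hE` places this set in `M`.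
  · obtain ⟨k, hk⟩ := hπ ⟨X, hXN⟩
    convert hE k
    ext y
    rw [ZFSet.mem_sep]
    refine ⟨fun hy => ⟨hX hy, ?_⟩, fun ⟨hy, h⟩ => ?_⟩
    · rw [← hmemγ (hX hy), hk]; exact hy
    · rw [← hmemγ hy, hk] at h; exact h

/-! ### Ordinals below `κ` and short sequences as elements of `H(θ)`. -/

section Sequences

variable {κ θ : Cardinal.{u}}

theorem mem_toZFSet_position {x : κ.ord.ToType} {z : ZFSet.{u}} :
    z ∈ (position x).toZFSet ↔ ∃ y < x, (position y).toZFSet = z := by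
  rw [Ordinal.mem_toZFSet_iff]
  constructor
  · rintro ⟨o, ho, rfl⟩
    obtain ⟨y, rfl⟩ := exists_position_eq (ho.trans (position_lt x))
    exact ⟨y, position_lt_position.1 ho, rfl⟩
  · rintro ⟨y, hy, rfl⟩
    exact ⟨_, position_lt_position.2 hy, rfl⟩

theorem mem_toZFSet_ord {z : ZFSet.{u}} :
    z ∈ κ.ord.toZFSet ↔ ∃ y : κ.ord.ToType, (position y).toZFSet = z := by
  rw [Ordinal.mem_toZFSet_iff]
  constructor
  · rintro ⟨o, ho, rfl⟩
    obtain ⟨y, rfl⟩ := exists_position_eq ho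
    exact ⟨y, rfl⟩
  · rintro ⟨y, rfl⟩
    exact ⟨_, position_lt y, rfl⟩

theorem IsNormalMeasure.exists_eventually_eq_toZFSet {U : Ultrafilter κ.ord.ToType}
    (hU : IsNormalMeasure U) (F : κ.ord.ToType → ZFSet.{u})
    (hF : ∀ᶠ x in (U : Filter κ.ord.ToType), F x ∈ (position x).toZFSet) :
    ∃ y : κ.ord.ToType, ∀ᶠ x in (U : Filter κ.ord.ToType), F x = (position y).toZFSet := by
  have : Nonempty κ.ord.ToType := ⟨hF.exists.choose⟩
  choose! h hh using fun x (hx : F x ∈ (position x).toZFSet) => mem_toZFSet_position.1 hx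
  obtain ⟨y, hy⟩ := hU.regressive h (hF.mono fun x hx => (hh x hx).1)
  refine ⟨y, ?_⟩
  filter_upwards [hF, hy] with x hx hxy
  rw [← hxy, (hh x hx).2]

/-- A point of `κ` as an element of `H(θ)`. -/
noncomputable def pointH (h : κ ≤ θ) (x : κ.ord.ToType) : H θ :=
  ⟨(position x).toZFSet, toZFSet_mem_H (by
    rw [← mk_Iio_eq_card_position]; exact (mk_Iio_ord_lt x).trans_le h)⟩

/-- A function from an ordinal below `κ` to `H(θ)` as an element of `H(θ)`. -/
noncomputable def seqH (hθ : θ.IsRegular) (h : κ ≤ θ) (b : κ.ord.ToType) (s : Iio b → H θ) : H θ :=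
  ⟨ZFSet.range fun i : Iio b => ZFSet.pair (position i.1).toZFSet (s i).1,
    range_mem_H hθ ((mk_Iio_ord_lt b).trans_le h) fun i =>
      pair_mem_H hθ (pointH h i.1).2 (s i).2⟩

theorem exists_eq_range_pair {b : κ.ord.ToType} {M f : ZFSet.{u}}
    (hf : ZFSet.IsFunc (position b).toZFSet M f) : ∃ s : Iio b → ZFSet.{u}, (∀ i, s i ∈ M) ∧
      f = ZFSet.range fun i : Iio b => ZFSet.pair (position i.1).toZFSet (s i) := by
  have h : ∀ i : Iio b, ∃! w, ZFSet.pair (position i.1).toZFSet w ∈ f := fun i =>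
    hf.2 _ (mem_toZFSet_position.2 ⟨i.1, i.2, rfl⟩)
  choose s hs hs' using h
  refine ⟨s, fun i => (ZFSet.pair_mem_prod.1 (hf.1 (hs i))).2, ?_⟩
  ext p
  rw [ZFSet.mem_range]
  constructor
  · intro hp
    obtain ⟨a, ha, w, hw, rfl⟩ := ZFSet.mem_prod.1 (hf.1 hp)
    obtain ⟨y, hy, rfl⟩ := mem_toZFSet_position.1 ha
    exact ⟨⟨y, hy⟩, by rw [hs' ⟨y, hy⟩ w hp]⟩
  · rintro ⟨i, rfl⟩
    exact hs i

end Sequences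

/-! ### Models witnessing that `κ` is `κ`-Ramsey. -/

open Classical in
/-- A solution of `R s`, if there is one. -/
noncomputable def solution {X : Type*} (R : (ℕ → X) → X → Prop) (s : ℕ → X) : X :=
  if h : ∃ y, R s y then h.choose else s 0

theorem solution_spec {X : Type*} {R : (ℕ → X) → X → Prop} {s : ℕ → X} (h : ∃ y, R s y) :
    R s (solution R s) := by
  rw [solution, dif_pos h]
  exact h.choose_spec

theorem exists_range_eq_baseRels (θ : Cardinal.{u}) :
    ∃ R : ℕ → (ℕ → H θ) → H θ → Prop, baseRels θ = range R :=
  (countable_baseRels θ).exists_eq_range ⟨pairRel θ, by simp [baseRels]⟩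

/-- The requirement on `M` in the definition of `α`-Ramsey cardinals, for `A ⊆ κ` and `H(θ)`. -/
def HasRamseyModel (α κ θ : Cardinal.{u}) (A : ZFSet.{u}) : Prop :=
  ∃ M : ZFSet.{u}, A ∈ M ∧ IsWeakModel κ M ∧
    IsElementarySubmodel (M : Set ZFSet.{u}) (H θ) ∧ ClosedUnderSeq α M ∧
    ∃ N : ZFSet.{u}, N.IsTransitive ∧
      ∃ j : (M : Set ZFSet.{u}) ↪ₑ[setLang] (N : Set ZFSet.{u}), IsPowersetPreserving κ j

theorem IsNormalMeasure.countableInterFilter {κ : Cardinal.{u}} {U : Ultrafilter κ.ord.ToType}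
    (hU : IsNormalMeasure U) (hκ : ℵ₀ < κ) :
    CountableInterFilter (U : Filter κ.ord.ToType) := by
  refine ⟨fun S hS h => ?_⟩
  have : #S < κ := (mk_le_aleph0_iff.2 hS.to_subtype).trans_lt hκ
  have := hU.complete (fun (s : S) x => x ∈ s.1) this fun s => h s.1 s.2
  filter_upwards [this] with x hx s hs using hx ⟨s, hs⟩

theorem IsNormalMeasure.hasRamseyModel_self {κ θ : Cardinal.{u}} {U : Ultrafilter κ.ord.ToType}
    (hU : IsNormalMeasure U) (hκ : κ.IsRegular) (hκ₀ : ℵ₀ < κ) (hκ₂ : ∀ c < κ, 2 ^ c < κ)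
    (hθ : θ.IsRegular) (hκθ : κ < θ) {A : ZFSet.{u}} (hA : A ⊆ κ.ord.toZFSet) :
    HasRamseyModel κ κ θ A := by
  have := hU.countableInterFilter hκ₀
  obtain ⟨x₀⟩ : Nonempty κ.ord.ToType := by
    rw [← mk_ne_zero_iff, mk_ord_toType]
    exact (aleph0_pos.trans hκ₀).ne'
  obtain ⟨R, hR⟩ := exists_range_eq_baseRels θ
  let kH : H θ := ⟨κ.ord.toZFSet, toZFSet_mem_H (by simpa using hκθ)⟩
  let aH : H θ := ⟨A, mem_H_of_subset kH.2 hA⟩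
  -- Besides the pointwise solutions, the operations give the constants `κ` and `A`, the identity
  -- function, which will represent `κ`, and the constant function whose value is the subset of `κ`
  -- represented by `s 0`.
  let op : ℕ ⊕ Fin 4 → (ℕ → κ.ord.ToType → H θ) → κ.ord.ToType → H θ := fun n s => match n with
    | .inl n => fun x => solution (R n) fun m => s m x
    | .inr 0 => fun _ => kH
    | .inr 1 => fun _ => aH
    | .inr 2 => pointH hκθ.le
    | .inr 3 => fun _ => ⟨ZFSet.sep (fun γ => ∀ᶠ x in (U : Filter κ.ord.ToType), γ ∈ (s 0 x).1)
        κ.ord.toZFSet, mem_H_of_subset kH.2 ZFSet.sep_subset⟩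
  obtain ⟨f, hf1, hf2, hf3⟩ := exists_closed_enumeration hκ hκ₀ hκ₂
    (fun c _ => pointH hκθ.le c) op (fun b s x => seqH hθ hκθ.le b fun i => s i x)
  -- Only constant functions contribute to `M`; the whole family is used for `N`. Operations on
  -- constants give constants where closure of `M` requires it.
  let ι := {k // ∃ x, f k = fun _ => x}
  let M : ZFSet.{u} := ZFSet.range fun k : ι => k.2.choose.1
  have hMem : ∀ x : H θ, x.1 ∈ M ↔ ∃ k, f k = fun _ => x := fun x => by
    simp only [M, ZFSet.mem_range]
    constructor
    · rintro ⟨k, hk⟩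
      exact ⟨k.1, by rw [k.2.choose_spec, Subtype.ext hk]⟩
    · rintro ⟨k, hk⟩
      have h : ∃ x, f k = fun _ => x := ⟨x, hk⟩
      refine ⟨⟨k, h⟩, ?_⟩
      have h' := congrFun (h.choose_spec.symm.trans hk) k
      exact congrArg Subtype.val h'
  have hMH : ∀ x ∈ M, x ∈ H θ := fun x hx => by
    obtain ⟨k, rfl⟩ := ZFSet.mem_range.1 hx
    exact Subtype.prop _
  have hg : ∀ R ∈ baseRels θ, SolvesPointwise R f := fun R' hR' s => by
    rw [hR] at hR'
    obtain ⟨n, rfl⟩ := hR'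
    obtain ⟨k, hk⟩ := hf2 (.inl n) s
    refine ⟨k, fun i hi => ?_⟩
    rw [hk]
    exact solution_spec hi
  have hM : IsSolutionClosed θ M := ⟨hMH, fun R' hR' s hs hsol => by
    rw [hR] at hR'
    obtain ⟨n, rfl⟩ := hR'
    choose k hk using fun n => (hMem (s n)).1 (hs n)
    obtain ⟨l, hl⟩ := hf2 (.inl n) k
    refine ⟨solution (R n) s, (hMem _).2 ⟨l, hl.trans ?_⟩, solution_spec hsol⟩
    simp only [op, Function.comp, hk]⟩
  have hsub : (κ.ord + 1).toZFSet ⊆ M := fun z hz => by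
    rw [Ordinal.toZFSet_add_one, ZFSet.mem_insert_iff] at hz
    rcases hz with rfl | hz
    · exact (hMem kH).2 (hf2 (.inr 0) fun _ => x₀)
    · obtain ⟨y, rfl⟩ := mem_toZFSet_ord.1 hz
      exact (hMem (pointH hκθ.le y)).2 (hf1 y)
  have hne : (M : Set ZFSet.{u}).Nonempty := ⟨_, hsub (Ordinal.toZFSet_mem_toZFSet_iff.2 (Order.lt_succ κ.ord))⟩
  have hcard : M.card ≤ κ := (card_range_le _).trans ((mk_subtype_le _).trans (mk_ord_toType κ).le)
  refine ⟨M, ?_, hM.isWeakModel hθ hκ₀.le hcard hsub, hM.isElementarySubmodel hne, ?_, ?_⟩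
  · exact (hMem aH).2 (hf2 (.inr 1) fun _ => x₀)
  · intro o ho F hF
    obtain ⟨b, rfl⟩ := exists_position_eq ho
    obtain ⟨s, hs, rfl⟩ := exists_eq_range_pair hF
    choose k hk using fun i => (hMem ⟨s i, hMH _ (hs i)⟩).1 (hs i)
    obtain ⟨l, hl⟩ := hf3 b k
    refine (hMem (seqH hθ hκθ.le b fun i => ⟨s i, hMH _ (hs i)⟩)).2 ⟨l, hl.trans ?_⟩
    simp only [Function.comp, hk]
  · choose J hJ using fun x : ↥(M : Set ZFSet.{u}) => (hMem ⟨x.1, hMH _ x.2⟩).1 x.2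
    obtain ⟨c, hc⟩ := hf2 (.inr 2) fun _ => x₀
    obtain ⟨hincl, hel⟩ := hM.isElementarySubmodel hne
    refine exists_isPowersetPreserving U f hg hsub J (fun n φ x => ?_) (fun x hx => ?_) c
      (fun i => ?_) (fun γ hγ => ?_) (fun k hk => ?_) (fun x hx h => ?_) (fun k => ?_)
    · simp only [hJ, eventually_const]
      exact (hel φ x).symm
    · simp only [hJ, eventually_const]
    · rw [hc]
      exact (ZFSet.isOrdinal_toZFSet _).isTransitive
    · obtain ⟨y, rfl⟩ := mem_toZFSet_ord.1 hγ
      filter_upwards [hU.tail y] with x hx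
      rw [hc]
      exact mem_toZFSet_position.2 ⟨y, hx, rfl⟩
    · rw [hc] at hk
      obtain ⟨y, hy⟩ := hU.exists_eventually_eq_toZFSet _ hk
      exact ⟨_, mem_toZFSet_ord.2 ⟨y, rfl⟩, hy⟩
    · obtain ⟨i, hi⟩ := h.exists
      rw [hJ, hc] at hi
      have := congrArg Subtype.val hi
      simp only [hx] at this
      exact (position_lt i).ne (Ordinal.toZFSet_injective this).symm
    · exact (hMem ⟨_, mem_H_of_subset kH.2 ZFSet.sep_subset⟩).2 (hf2 (.inr 3) fun _ => k)

/-- The formula `x = y`. -/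
def eqFormula : setLang.Formula (Fin 2) :=
  FirstOrder.Language.Term.equal (.var 0) (.var 1)

/-! ### Ramsey models for almost every cardinal below `κ`. -/

theorem exists_lt_forall_lt {κ : Cardinal.{u}} {a : κ.ord.ToType} (ha : (#(Iio a)).IsRegular)
    (ha' : (#(Iio a)).ord = position a) {ι : Type u} (hι : #ι < #(Iio a)) (s : ι → Iio a) :
    ∃ c < a, ∀ i, (s i).1 < c := by
  by_contra! h
  have hc : IsCofinal (range s) := fun b => by
    obtain ⟨i, hi⟩ := h b.1 b.2
    exact ⟨s i, ⟨i, rfl⟩, hi⟩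
  have := Order.cof_le hc
  rw [Order.cof_Iio] at this
  change (position a).cof ≤ _ at this
  rw [← ha', ha.cof_ord] at this
  exact (this.trans mk_range_le).not_gt hι

theorem IsNormalMeasure.eventually_lt_mk_Iio {κ : Cardinal.{u}} {U : Ultrafilter κ.ord.ToType}
    (hU : IsNormalMeasure U) {β : Cardinal.{u}} (hβ : β < κ) :
    ∀ᶠ x in (U : Filter κ.ord.ToType), (#(Iio x)).ord = position x → β < #(Iio x) := by
  obtain ⟨w, hw⟩ : ∃ w : κ.ord.ToType, position w = β.ord := exists_position_eq (ord_lt_ord.2 hβ)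
  filter_upwards [hU.tail w] with x hx h
  rw [← ord_lt_ord, h, ← hw]
  exact position_lt_position.2 hx

theorem IsNormalMeasure.eventually_hasRamseyModel {κ θ : Cardinal.{u}}
    {U : Ultrafilter κ.ord.ToType} (hU : IsNormalMeasure U) (hκ : κ.IsRegular) (hκ₀ : ℵ₀ < κ)
    (hκ₂ : ∀ c < κ, 2 ^ c < κ) (hθ : θ.IsRegular) (hκθ : κ < θ) :
    ∀ᶠ a in (U : Filter κ.ord.ToType), ∀ A ⊆ (position a).toZFSet,
      HasRamseyModel #(Iio a) #(Iio a) θ A := by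
  have := hU.countableInterFilter hκ₀
  obtain ⟨R, hR⟩ := exists_range_eq_baseRels θ
  -- One subset of each `a` suffices: `A a` is a counterexample if there is one, so a model for `A
  -- a` yields models for all subsets.
  have hA : ∀ a : κ.ord.ToType, ∃ A : H θ, HasRamseyModel #(Iio a) #(Iio a) θ A.1 →
      ∀ B ⊆ (position a).toZFSet, HasRamseyModel #(Iio a) #(Iio a) θ B := fun a => by
    by_cases h : ∀ B ⊆ (position a).toZFSet, HasRamseyModel #(Iio a) #(Iio a) θ B
    · exact ⟨pointH hκθ.le a, fun _ => h⟩
    · push Not at h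
      obtain ⟨B, hB, hB'⟩ := h
      exact ⟨⟨B, mem_H_of_subset (pointH hκθ.le a).2 hB⟩, fun h => (hB' h).elim⟩
  choose A hA using hA
  -- The function `(x, y) ↦ x` will represent the critical point, and `A x` the chosen subset. The
  -- third operation computes the subset of `x` represented by `s 0 x`. The last one, `y ↦ s 0 y y`,
  -- defines the embedding.
  let op : ℕ ⊕ Fin 4 → (ℕ → κ.ord.ToType → κ.ord.ToType → H θ) →
      κ.ord.ToType → κ.ord.ToType → H θ := fun n s => match n with
    | .inl n => fun x y => solution (R n) fun m => s m x y
    | .inr 0 => fun x _ => pointH hκθ.le x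
    | .inr 1 => fun x _ => A x
    | .inr 2 => fun x _ => ⟨ZFSet.sep (fun γ => ∀ᶠ y in (U : Filter κ.ord.ToType), γ ∈ (s 0 x y).1)
        (position x).toZFSet, mem_H_of_subset (pointH hκθ.le x).2 ZFSet.sep_subset⟩
    | .inr 3 => fun _ y => s 0 y y
  obtain ⟨f, hf1, hf2, hf3⟩ := exists_closed_enumeration hκ hκ₀ hκ₂
    (fun c _ _ => pointH hκθ.le c) op (fun b s x y => seqH hθ hκθ.le b fun i => s i x y)
  choose i1 hi1 using hf1
  choose i2 hi2 using hf2
  choose i3 hi3 using hf3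
  have hN : #(ULift.{u} ℕ) < κ := by simpa using hκ₀
  -- Diagonal intersections: for a fixed bound `c` there are fewer than `κ` short sequences of
  -- indices below `c`, so almost every `a` is closed under the index functions and, in `t4`,
  -- decides formulas at `(a, a)` as almost all `(y, y)` do.
  have t1 : ∀ᶠ a in (U : Filter κ.ord.ToType), ∀ c < a, i1 c < a :=
    hU.diagonal fun c => hU.tail _
  have t2 : ∀ᶠ a in (U : Filter κ.ord.ToType), ∀ c < a, ∀ n, ∀ s : ULift.{u} ℕ → Iio c,
      i2 n (fun m => (s ⟨m⟩).1) < a :=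
    hU.diagonal fun c => eventually_countable_forall.2 fun n =>
      hU.complete _ (mk_fun_Iio_lt hκ₂ hκ₀.le hN c) fun s => hU.tail _
  have t3 : ∀ᶠ a in (U : Filter κ.ord.ToType), ∀ c < a, ∀ b : Iic c, ∀ s : Iio b.1 → Iio c,
      i3 b (fun i => (s i).1) < a :=
    hU.diagonal fun c => hU.complete _ (mk_Iic_lt hκ₀.le c) fun b =>
      hU.complete _ (mk_fun_Iio_lt hκ₂ hκ₀.le (mk_Iio_ord_lt b.1) c) fun s => hU.tail _
  have t4 : ∀ᶠ a in (U : Filter κ.ord.ToType), ∀ c < a, ∀ n, ∀ φ : setLang.Formula (Fin n),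
      ∀ s : ULift.{u} (Fin n) → Iio c, φ.Realize (fun j => f (s ⟨j⟩).1 a a) ↔
        ∀ᶠ y in (U : Filter κ.ord.ToType), φ.Realize (fun j => f (s ⟨j⟩).1 y y) :=
    hU.diagonal fun c => eventually_countable_forall.2 fun n => eventually_countable_forall.2
      fun φ => hU.complete _ (mk_fun_Iio_lt hκ₂ hκ₀.le
        (by simpa using natCast_lt_aleph0.trans hκ₀) c) fun s => by
        by_cases h : ∀ᶠ y in (U : Filter κ.ord.ToType), φ.Realize (fun j => f (s ⟨j⟩).1 y y)
        · filter_upwards [h] with a ha using iff_of_true ha h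
        · filter_upwards [Ultrafilter.eventually_not.2 h] with a ha using iff_of_false ha h
  filter_upwards [hU.eventually_isRegular hκ hκ₀, hU.eventually_lt_mk_Iio hκ₀, t1, t2, t3, t4]
    with a ⟨hreg, hord⟩ hunc t1 t2 t3 t4
  replace hunc := hunc hord
  refine hA a ?_
  have hbound : ∀ {ι : Type u}, #ι < #(Iio a) → ∀ s : ι → Iio a, ∃ c < a, ∀ i, (s i).1 < c :=
    fun hι s => exists_lt_forall_lt hreg hord hι s
  have u2 : ∀ n (s : ℕ → Iio a), i2 n (fun m => (s m).1) < a := fun n s => by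
    obtain ⟨c, hc, hs⟩ := hbound (ι := ULift.{u} ℕ) (by simpa using hunc) fun m => s m.down
    exact t2 c hc n fun m => ⟨_, hs m⟩
  have u3 : ∀ b < a, ∀ s : Iio b → Iio a, i3 b (fun i => (s i).1) < a := fun b hb s => by
    have hb' : #(Iio b) < #(Iio a) := by
      rw [mk_Iio_eq_card_position b, ← lt_ord, hord]
      exact position_lt_position.2 hb
    obtain ⟨c, hc, hs⟩ := hbound hb' s
    -- A single bound must control both the length `b` and the entries of the sequence.
    exact t3 (max b c) (max_lt hb hc) ⟨b, le_max_left b c⟩ fun i =>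
      ⟨_, (hs i).trans_le (le_max_right _ _)⟩
  have u4 : ∀ {n} (φ : setLang.Formula (Fin n)) (s : Fin n → Iio a),
      φ.Realize (fun j => f (s j).1 a a) ↔
        ∀ᶠ y in (U : Filter κ.ord.ToType), φ.Realize (fun j => f (s j).1 y y) := fun {n} φ s => by
    obtain ⟨c, hc, hs⟩ := hbound (ι := ULift.{u} (Fin n))
      (by simpa using natCast_lt_aleph0.trans hunc) fun m => s m.down
    exact t4 c hc n φ fun j => ⟨_, hs j⟩
  have ueq : ∀ i j : Iio a, f i.1 a a = f j.1 a a →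
      ∀ᶠ y in (U : Filter κ.ord.ToType), f i.1 y y = f j.1 y y := fun i j h =>
    (u4 eqFormula ![i, j]).1 h
  obtain ⟨x₀⟩ : Nonempty (Iio a) := by
    rw [← mk_ne_zero_iff]
    exact (aleph0_pos.trans hunc).ne'
  let M : ZFSet.{u} := ZFSet.range fun k : Iio a => (f k.1 a a).1
  have hMem : ∀ x : H θ, x.1 ∈ M ↔ ∃ k : Iio a, f k.1 a a = x := fun x => by
    simp only [M, ZFSet.mem_range, Subtype.ext_iff]
  have hMH : ∀ x ∈ M, x ∈ H θ := fun x hx => by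
    obtain ⟨k, rfl⟩ := ZFSet.mem_range.1 hx
    exact Subtype.prop _
  have hg : ∀ R ∈ baseRels θ, SolvesPointwise R fun k : Iio a => f k.1 a := fun R' hR' s => by
    rw [hR] at hR'
    obtain ⟨n, rfl⟩ := hR'
    refine ⟨⟨_, u2 (.inl n) s⟩, fun y hy => ?_⟩
    simp only [hi2]
    exact solution_spec hy
  have hM : IsSolutionClosed θ M := ⟨hMH, fun R' hR' s hs hsol => by
    rw [hR] at hR'
    obtain ⟨n, rfl⟩ := hR'
    choose k hk using fun n => (hMem (s n)).1 (hs n)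
    refine ⟨solution (R n) s, (hMem _).2 ⟨⟨_, u2 (.inl n) k⟩, ?_⟩, solution_spec hsol⟩
    simp only [hi2, op, Function.comp, hk]⟩
  have hpt : ∀ y < a, (position y).toZFSet ∈ M := fun y hy =>
    (hMem (pointH hκθ.le y)).2 ⟨⟨_, t1 y hy⟩, by simp only [hi1]⟩
  let ca : Iio a := ⟨_, u2 (.inr 0) fun _ => x₀⟩
  have hca : ∀ x y, f ca.1 x y = pointH hκθ.le x := fun x y => by simp only [ca, hi2, op]
  have hsub : ((#(Iio a)).ord + 1).toZFSet ⊆ M := fun z hz => by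
    rw [hord, Ordinal.toZFSet_add_one, ZFSet.mem_insert_iff] at hz
    rcases hz with rfl | hz
    · exact (hMem (pointH hκθ.le a)).2 ⟨ca, hca a a⟩
    · obtain ⟨y, hy, rfl⟩ := mem_toZFSet_position.1 hz
      exact hpt y hy
  have hne : (M : Set ZFSet.{u}).Nonempty := ⟨_, hpt x₀.1 x₀.2⟩
  refine ⟨M, ?_, hM.isWeakModel hθ hunc.le (card_range_le _) hsub, hM.isElementarySubmodel hne,
    ?_, ?_⟩
  · exact (hMem (A a)).2 ⟨⟨_, u2 (.inr 1) fun _ => x₀⟩, by simp only [hi2, op]⟩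
  · intro o ho F hF
    rw [hord] at ho
    obtain ⟨b, rfl⟩ := exists_position_eq (ho.trans (position_lt a))
    obtain ⟨s, hs, rfl⟩ := exists_eq_range_pair hF
    choose k hk using fun i => (hMem ⟨s i, hMH _ (hs i)⟩).1 (hs i)
    refine (hMem (seqH hθ hκθ.le b fun i => ⟨s i, hMH _ (hs i)⟩)).2
      ⟨⟨_, u3 b (position_lt_position.1 ho) k⟩, ?_⟩
    simp only [hi3, Function.comp, hk]
  · choose e he using fun x : ↥(M : Set ZFSet.{u}) => (hMem ⟨x.1, hMH _ x.2⟩).1 x.2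
    obtain ⟨hincl, hel⟩ := hM.isElementarySubmodel hne
    -- The value `f k a a` goes to the diagonal function `y ↦ f k y y`. It depends on the choice of
    -- `k` only up to a null set, by `ueq`.
    let J : ↥(M : Set ZFSet.{u}) → Iio a := fun x => ⟨_, u2 (.inr 3) fun _ => e x⟩
    have hJ : ∀ x y, f (J x).1 a y = f (e x).1 y y := fun x y => by simp only [J, hi2, op, Function.comp]
    refine exists_isPowersetPreserving U (fun k : Iio a => f k.1 a) hg hsub J (fun n φ x => ?_)
      (fun x hx => ?_) ca (fun i => ?_) (fun γ hγ => ?_) (fun k hk => ?_) (fun x hx h => ?_)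
      (fun k => ?_)
    · simp only [hJ]
      rw [← u4 φ fun j => e (x j)]
      simp only [he]
      exact (hel φ x).symm
    · rw [hord] at hx
      obtain ⟨y, hy, hxy⟩ := mem_toZFSet_position.1 hx
      filter_upwards [ueq (e x) ⟨_, t1 y hy⟩
        (by rw [he]; simp only [hi1]; exact Subtype.ext hxy.symm)] with z hz
      rw [hJ, hz]
      simp only [hi1]
      exact hxy
    · simp only [hca]
      exact (ZFSet.isOrdinal_toZFSet _).isTransitive
    · rw [hord] at hγ
      simp only [hca]
      exact .of_forall fun _ => hγ
    · simp only [hca] at hk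
      -- Here `a` is fixed, so completeness alone suffices: a function into fewer than `κ` values is
      -- constant on a large set.
      obtain ⟨y, hy⟩ := hU.exists_eventually_eq (mk_Iio_ord_lt a) (fun x => (f k.1 a x).1)
        (fun y : Iio a => (position y.1).toZFSet) (hk.mono fun x hx => by
          obtain ⟨y, hy, h⟩ := mem_toZFSet_position.1 hx
          exact ⟨⟨y, hy⟩, h.symm⟩)
      exact ⟨_, by rw [hord]; exact mem_toZFSet_position.2 ⟨y.1, y.2, rfl⟩, hy⟩
    · rw [hord] at hx
      -- On the diagonal `(x, y) ↦ x` becomes the identity, so the image of `a` is represented by `y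
      -- ↦ y`, which exceeds `a` almost everywhere.
      have hxc := ueq (e x) ca (by rw [he, hca]; exact Subtype.ext hx)
      obtain ⟨y, ⟨hy, hy'⟩, hay⟩ := ((h.and hxc).and (hU.tail a)).exists
      rw [hJ, hy', hca, hca] at hy
      have := Ordinal.toZFSet_injective (congrArg Subtype.val hy)
      exact hay.ne' (position_inj.1 this)
    · rw [hord]
      exact (hMem ⟨ZFSet.sep (fun γ => ∀ᶠ y in (U : Filter κ.ord.ToType), γ ∈ (f k.1 a y).1)
        (position a).toZFSet, mem_H_of_subset (pointH hκθ.le a).2 ZFSet.sep_subset⟩).2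
        ⟨⟨_, u2 (.inr 2) fun _ => k⟩, by simp only [hi2, op, Function.comp]⟩

/-! ### Conclusion. -/

theorem isRamsey_iff {κ : Cardinal.{u}} (hκ : κ.IsRegular) : IsRamsey κ κ ↔
    ∀ μ : Cardinal.{u}, ∃ θ, μ ≤ θ ∧ θ.IsRegular ∧
      ∀ A : ZFSet.{u}, A ⊆ κ.ord.toZFSet → HasRamseyModel κ κ θ A :=
  ⟨fun h => h.2.2.2, fun h => ⟨le_rfl, hκ, hκ, h⟩⟩

theorem IsMeasurable.exists_isNormalMeasure {κ : Cardinal.{u}} (hκ : IsMeasurable κ) :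
    κ.IsRegular ∧ (∀ c < κ, 2 ^ c < κ) ∧
      ∃ U : Ultrafilter κ.ord.ToType, IsNormalMeasure U := by
  obtain ⟨h0, U, hU, hc⟩ := hκ
  exact ⟨isRegular_of_complete h0.le hU, fun c => two_power_lt_of_complete hU,
    LargeCardinal.exists_isNormalMeasure h0 hU⟩

theorem IsMeasurable.isRamsey {κ : Cardinal.{u}} (hκ : IsMeasurable κ) : IsRamsey κ κ := by
  obtain ⟨hreg, h2, U, hU⟩ := hκ.exists_isNormalMeasure
  refine (isRamsey_iff hreg).2 fun μ => ⟨Order.succ (max κ μ),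
    (le_max_right _ _).trans (Order.le_succ _),
    isRegular_succ (hκ.1.le.trans (le_max_left _ _)), fun A hA => ?_⟩
  exact hU.hasRamseyModel_self hreg hκ.1 h2 (isRegular_succ (hκ.1.le.trans (le_max_left _ _)))
    ((le_max_left _ _).trans_lt (Order.lt_succ _)) hA

theorem IsMeasurable.exists_isRamsey_lt {κ : Cardinal.{u}} (hκ : IsMeasurable κ)
    {β : Cardinal.{u}} (hβ : β < κ) :
    ∃ α : Cardinal.{u}, β < α ∧ α < κ ∧ α.IsRegular ∧ IsRamsey α α := by
  obtain ⟨hreg, h2, U, hU⟩ := hκ.exists_isNormalMeasure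
  by_contra! hcon
  have hfail : ∀ a : κ.ord.ToType, ∃ μ : Cardinal.{u}, (#(Iio a)).IsRegular → β < #(Iio a) →
      ∀ θ, μ ≤ θ → θ.IsRegular →
        ¬ ∀ A ⊆ (#(Iio a)).ord.toZFSet, HasRamseyModel #(Iio a) #(Iio a) θ A := fun a => by
    by_cases h : (#(Iio a)).IsRegular ∧ β < #(Iio a)
    · have := hcon _ h.2 (mk_Iio_ord_lt a) h.1
      rw [isRamsey_iff h.1] at this
      push Not at this
      obtain ⟨μ, hμ⟩ := this
      refine ⟨μ, fun _ _ θ h1 h2 h3 => ?_⟩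
      obtain ⟨A, hA, hA'⟩ := hμ θ h1 h2
      exact hA' (h3 A hA)
    · exact ⟨0, fun h1 h2 => (h ⟨h1, h2⟩).elim⟩
  choose μ hμ using hfail
  -- The large set of good `a` depends on `θ`, so one `θ` is taken beyond all the bounds `μ a` past
  -- which the respective `a` would fail.
  let θ := Order.succ (max κ (⨆ a, μ a))
  have hθ : θ.IsRegular := isRegular_succ (hκ.1.le.trans (le_max_left _ _))
  obtain ⟨a, ⟨⟨hra, hoa⟩, hβa⟩, hA⟩ := (((hU.eventually_isRegular hreg hκ.1).and
    (hU.eventually_lt_mk_Iio hβ)).and (hU.eventually_hasRamseyModel hreg hκ.1 h2 hθ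
      ((le_max_left _ _).trans_lt (Order.lt_succ _)))).exists
  refine hμ a hra (hβa hoa) θ ?_ hθ (by rwa [hoa])
  exact ((le_ciSup bddAbove_of_small a).trans (le_max_right _ _)).trans (Order.le_succ _)

end LargeCardinal

theorem mainTheorem11 (κ : Cardinal.{u}) (hκ : LargeCardinal.IsMeasurable κ) :
    (∀ β : Cardinal.{u}, β < κ → ∃ α : Cardinal.{u}, β < α ∧ α < κ ∧ α.IsRegular ∧
      LargeCardinal.IsRamsey α α) ∧
    LargeCardinal.IsRamsey κ κ ∧
    ∃ α : Cardinal.{u}, α < κ ∧ α.IsRegular ∧ LargeCardinal.IsRamsey α α ∧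
      ¬ LargeCardinal.IsMeasurable α := by
  refine ⟨fun β hβ => hκ.exists_isRamsey_lt hβ, hκ.isRamsey, ?_⟩
  -- Below the least measurable cardinal no cardinal is measurable, but some are Ramsey.
  obtain ⟨μ, hμ, hmin⟩ := (Cardinal.lt_wf).has_min {μ | LargeCardinal.IsMeasurable μ} ⟨κ, hκ⟩
  obtain ⟨α, -, hα, hreg, hram⟩ := hμ.exists_isRamsey_lt (Cardinal.aleph0_pos.trans hμ.1)
  exact ⟨α, hα.trans_le (not_lt.1 (hmin κ hκ)), hreg, hram, fun h => hmin α h hα⟩
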